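/- Let $G$ be a group with a rotary pair $(a,z)$, that is, $G=\langle a,z\rangle$, $|a|$ is finite, $|z|=2$ and $z\notin\langle a\rangle$. Write $x^g=g^{-1}xg$, and put $H=\langle a\rangle$, $J=\langle z\rangle$, $K=\langle az\rangle$. Assume that $|a|\ge 3$, $H\neq H^z$ and $m:=|az|$ is finite, and let $k=|H:H\cap H^z|$, $\lambda=|H\cap H^z|$ and $\lambda'=|H\cap K|$. Let $\mathrm{Cos}(G,H,J,K)$ be the incidence configuration with vertex set $V=[G:H]$, edge set $E=[G:J]$ and face set $F=[G:K]$ (right cosets), two elements of different types being incident when they intersect, with $G$ acting by right multiplication. Let $f=K\in F$, $e=J\in E$, let $C(az)=(e_0,\dots,e_{m-1})$ with $e_i=J(az)^i$, and let the boundary cycle $C(f)$ be the sequence class of $C(az)$ (all cyclic shifts of $C(az)$ and of its reverse). A cycle is a cyclic sequence of at least three pairwise distinct edges, consecutive ones meeting in consecutive vertices; it is simple if its vertices are pairwise distinct, and regular if its length is $n\mu$, where $n$ is its number of distinct vertices and the vertex sequence has period $n$. For a cycle $C$, $[C]$ is the edge-induced subgraph, and $\mathbf C_n^{(\mu)}$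 is the $n$-cycle with every edge replaced by $\mu$ parallel edges. Then the following hold. (a) $\mathrm{Cos}(G,H,J,K)$ gives rise to a locally finite $G$-rotary map $\mathsf{RotaMap}(G,a,z)$: its underlying graph $\Gamma=(V,E)$ is connected and locally finite and is 2-cell embedded in a surface (a connected 2-manifold without boundary, compact if $G$ is finite) with the elements of $F$ as faces, where a vertex or an edge is incident with a face exactly when it lies on its boundary cycle; $G$ acts faithfully as a group of automorphisms of the map (that is, on $V\cup E$, preserving incidence and boundary cycles), transitively on arcs, each vertex stabiliser induces a transitive cyclic group on the edges at that vertex, and each face stabiliser induces a cyclic group on the edges of that face. The graph has valency $k$ and edge-multiplicity $\lambda$, and every face has length $m$. (b) For each $g\in G$, the boundary cycle of the face $f^g=Kg$ is the image of $C(f)$ under $g$. The boundary cycle of each face is a regular $m$-cycle with induced subgraph isomorphic to $\mathbf C_{m/\lambda'}^{(\lambda')}$, where $m/\lambda'\ge 3$ and $\lambda'$ divides $\gcd(m,\lambda)$; and $G_f=G_{C(f)}=\langle az\rangle$. (c) The kernels of the $G$-actions on $V$ and on $V\cup F$ are $G_{(V)}=\langle a\rangle\cap\langle a^z\rangle$ and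 $G_{(V\cup F)}=\langle a\rangle\cap\langle az\rangle\cong\mathbb Z_{\lambda'}$. The map is circular (all boundary cycles are simple cycles) if and only if $G$ acts faithfully on $V\cup F$, equivalently if and only if $\lambda'=1$. (d) The faces incident with the edge $e=\langle z\rangle$ are exactly $f$ and $f^z$; they are distinct, and $z$ interchanges them. -/

import Mathlib

open scoped Pointwise
open MulOpposite (op)

universe u

namespace RotaryMaps

/-! ### Graphs with multiple edges -/

/-- An incidence structure of vertices and edges. -/
structure IncGraph (V E : Type*) where
  Inc : V → E → Prop

namespace IncGraph

variable {V E V' E' : Type*}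

/-- A graph: every edge is incident with exactly two distinct vertices. -/
def IsGraph (Γ : IncGraph V E) : Prop :=
  ∀ e, ∃ v w, v ≠ w ∧ ∀ u, Γ.Inc u e ↔ u = v ∨ u = w

/-- Two distinct vertices are adjacent if some edge is incident with both. -/
def Adj (Γ : IncGraph V E) (v w : V) : Prop :=
  v ≠ w ∧ ∃ e, Γ.Inc v e ∧ Γ.Inc w e

/-- A (non-empty) graph in which any two vertices are joined by a walk. -/
def IsConnected (Γ : IncGraph V E) : Prop :=
  Nonempty V ∧ ∀ v w, Relation.ReflTransGen Γ.Adj v w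

/-- Every vertex is on finitely many edges. -/
def IsLocallyFinite (Γ : IncGraph V E) : Prop :=
  ∀ v, {e | Γ.Inc v e}.Finite

/-- Every vertex has exactly `k` neighbours. -/
def HasValency (Γ : IncGraph V E) (k : ℕ) : Prop :=
  ∀ v, {w | Γ.Adj v w}.encard = k

/-- Any two adjacent vertices are joined by exactly `n` edges. -/
def HasEdgeMultiplicity (Γ : IncGraph V E) (n : ℕ) : Prop :=
  ∀ v w, Γ.Adj v w → {e | Γ.Inc v e ∧ Γ.Inc w e}.encard = n

/-- An isomorphism of incidence structures. -/
structure Iso (Γ : IncGraph V E) (Δ : IncGraph V' E') where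
  onVertices : V ≃ V'
  onEdges : E ≃ E'
  inc_iff : ∀ v e, Δ.Inc (onVertices v) (onEdges e) ↔ Γ.Inc v e

/-- The edge-induced subgraph `[S]` on a set `S` of edges: its vertices are the vertices incident
with some edge in `S`. -/
def edgeInduced (Γ : IncGraph V E) (S : Set E) :
    IncGraph {v : V // ∃ e ∈ S, Γ.Inc v e} {e : E // e ∈ S} where
  Inc v e := Γ.Inc v.1 e.1

/-- The `μ`-extender: each edge is replaced by `μ` edges with the same ends. -/
def extender (Γ : IncGraph V E) (μ : ℕ) : IncGraph V (E × Fin μ) where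
  Inc v e := Γ.Inc v e.1

/-- A cycle of length at least `3`, given as the sequence `l = (e₀, …, e_{ℓ-1})` of its pairwise
distinct edges, where `e_i` has the two ends `α i` and `α (i + 1)`, subscripts of `α` being read
modulo `ℓ`. The vertices may be repeated. -/
structure IsCycleThrough (Γ : IncGraph V E) (l : List E) (α : ℕ → V) : Prop where
  three_le : 3 ≤ l.length
  nodup : l.Nodup
  periodic : ∀ i, α (i + l.length) = α i
  ends_ne : ∀ i, α i ≠ α (i + 1)
  ends : ∀ (i : ℕ) (h : i < l.length) (v : V), Γ.Inc v l[i] ↔ v = α i ∨ v = α (i + 1)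

def IsCycle (Γ : IncGraph V E) (l : List E) : Prop :=
  ∃ α, Γ.IsCycleThrough l α

/-- A cycle whose vertices are pairwise distinct. -/
def IsSimpleCycle (Γ : IncGraph V E) (l : List E) : Prop :=
  ∃ α, Γ.IsCycleThrough l α ∧ ∀ i < l.length, ∀ j < l.length, α i = α j → i = j

/-- A regular cycle: its length is `n * μ`, it has `n` distinct vertices, and these repeat with
period `n`. -/
def IsRegularCycle (Γ : IncGraph V E) (l : List E) : Prop :=
  ∃ (α : ℕ → V) (n μ : ℕ), Γ.IsCycleThrough l α ∧ l.length = n * μ ∧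
    (Set.range α).encard = n ∧ ∀ i, α (i + n) = α i

end IncGraph

/-- The simple cycle `C_n` (used for `n ≥ 3`): the edge `i` joins `i` and `i + 1` modulo `n`. -/
def cycleGraph (n : ℕ) : IncGraph (ZMod n) (ZMod n) where
  Inc v e := v = e ∨ v = e + 1

/-- The sequence class of an edge sequence: start at any of its entries, move in either
direction. -/
def seqClass {E : Type*} (l : List E) : Set (List E) :=
  {c | c ~r l ∨ c ~r l.reverse}

/-! ### Surfaces and maps -/

/-- A connected 2-manifold without boundary (Hausdorff, second countable, locally homeomorphic to
the plane). -/
structure IsSurface (S : Type*) [TopologicalSpace S] : Prop where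
  t2 : T2Space S
  secondCountable : SecondCountableTopology S
  connected : ConnectedSpace S
  locallyEuclidean : Nonempty (ChartedSpace (EuclideanSpace ℝ (Fin 2)) S)

/-- An incidence configuration of vertices, edges and faces. -/
structure IncConfig (V E F : Type*) extends IncGraph V E where
  IncVF : V → F → Prop
  IncEF : E → F → Prop

/-- An incidence configuration with a specified class of boundary sequences for each face. -/
structure MapConfig (V E F : Type*) extends IncConfig V E F where
  bdry : F → Set (List E)

section

variable {V E F : Type*}

/-- A 2-cell embedding in `S` of the underlying graph of `M`, with the faces of `M` as 2-cells and
the specified boundary cycles. Vertices are drawn as points `pt v`, edges as simple arcs `arc e`;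
`cell f` is a characteristic map of the face `f`, defined on the closed unit disc. -/
structure TwoCellEmbedding (M : MapConfig V E F) (S : Type*) [TopologicalSpace S] where
  pt : V → S
  arc : E → C(unitInterval, S)
  cell : F → ℂ → S
  pt_injective : Function.Injective pt
  arc_injective : ∀ e, Function.Injective (arc e)
  /-- the arc of `e` joins the two vertices incident with `e` -/
  arc_ends : ∀ e, pt '' {v | M.Inc v e} = {arc e 0, arc e 1}
  pt_notMem_arc : ∀ v e, pt v ∉ arc e '' Set.Ioo 0 1
  arc_disjoint : Pairwise fun e e' => Disjoint (arc e '' Set.Ioo 0 1) (arc e' '' Set.Ioo 0 1)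
  /-- edges do not accumulate (automatic for finite graphs) -/
  arc_locallyFinite : LocallyFinite fun e => Set.range (arc e)
  cell_continuousOn : ∀ f, ContinuousOn (cell f) (Metric.closedBall 0 1)
  /-- the face `f` is an open disc, open in `S` -/
  cell_isOpenEmbedding : ∀ f,
    Topology.IsOpenEmbedding ((Metric.ball (0 : ℂ) 1).domRestrict (cell f))
  cell_disjoint : Pairwise fun f f' =>
    Disjoint (cell f '' Metric.ball 0 1) (cell f' '' Metric.ball 0 1)
  /-- the faces are exactly what remains after removing the drawn graph -/
  iUnion_cell : ⋃ f, cell f '' Metric.ball 0 1 = (Set.range pt ∪ ⋃ e, Set.range (arc e))ᶜ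
  /-- the boundary circle of the disc of `f` runs once through the arcs of `e₀, …, e_{ℓ-1}` in this
  order, each in one of its two directions, for a boundary sequence of `f` -/
  cell_boundary : ∀ f, ∃ l ∈ M.bdry f, ∀ (i : ℕ) (h : i < l.length),
    (∀ t : unitInterval,
      cell f (Complex.exp (2 * Real.pi * Complex.I * ((i + (t : ℝ)) / l.length))) =
        arc l[i] t) ∨
    (∀ t : unitInterval,
      cell f (Complex.exp (2 * Real.pi * Complex.I * ((i + (t : ℝ)) / l.length))) =
        arc l[i] (unitInterval.symm t))

/-- `M` is a locally finite map with supporting surface `S`: its underlying graph is a connected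
locally finite graph, each face has a boundary cycle (one sequence class of cycles), a vertex or an
edge is incident with a face exactly if it lies on the boundary cycle, and the graph is 2-cell
embedded in `S` with these faces and boundary cycles. -/
structure IsMap (M : MapConfig V E F) (S : Type*) [TopologicalSpace S] : Prop where
  isGraph : M.IsGraph
  isConnected : M.IsConnected
  isLocallyFinite : M.IsLocallyFinite
  bdry_cycle : ∀ f, ∃ l, M.IsCycle l ∧ M.bdry f = seqClass l
  incEF_iff : ∀ f, ∀ l ∈ M.bdry f, ∀ e, M.IncEF e f ↔ e ∈ l
  incVF_iff : ∀ f, ∀ l ∈ M.bdry f, ∀ v, M.IncVF v f ↔ ∃ e ∈ l, M.Inc v e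
  isSurface : IsSurface S
  embedding : Nonempty (TwoCellEmbedding M S)

/-- All boundary cycles are simple cycles. -/
def IsCircular (M : MapConfig V E F) : Prop :=
  ∀ f, ∀ l ∈ M.bdry f, M.IsSimpleCycle l

/-- Every face has exactly `m` edges on its boundary. -/
def HasFaceLength (M : MapConfig V E F) (m : ℕ) : Prop :=
  ∀ f, {e | M.IncEF e f}.encard = m

/-! ### Groups of automorphisms -/

variable (A : Type*) [Group A] [MulAction A V] [MulAction A E] [MulAction A F]

/-- `A` acts faithfully as a group of automorphisms of the graph. -/
structure ActsOnGraph (Γ : IncGraph V E) : Prop where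
  inc_iff : ∀ (g : A) v e, Γ.Inc (g • v) (g • e) ↔ Γ.Inc v e
  faithful : FaithfulSMul A (V ⊕ E)

/-- `A` acts faithfully as a group of automorphisms of the map: incidences and boundary cycles
are preserved. -/
structure ActsOnMap (M : MapConfig V E F) : Prop where
  onGraph : ActsOnGraph A M.toIncGraph
  incVF_iff : ∀ (g : A) v f, M.IncVF (g • v) (g • f) ↔ M.IncVF v f
  incEF_iff : ∀ (g : A) e f, M.IncEF (g • e) (g • f) ↔ M.IncEF e f
  bdry_smul : ∀ (g : A) f, M.bdry (g • f) = List.map (g • ·) '' M.bdry f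

/-- Transitivity on arcs, an arc being an incident vertex-edge pair. -/
def ArcTransitive (Γ : IncGraph V E) : Prop :=
  ∀ v e v' e', Γ.Inc v e → Γ.Inc v' e' → ∃ g : A, g • v = v' ∧ g • e = e'

variable {A} in
/-- The group of permutations of the (invariant) set `X` induced by the subgroup `B` is cyclic. -/
def InducesCyclic (B : Subgroup A) (X : Set E) : Prop :=
  ∃ g ∈ B, ∀ h ∈ B, ∃ n : ℤ, ∀ x ∈ X, h • x = g ^ n • x

/-- Vertex-rotary graph: `A` is arc-transitive, and a vertex stabiliser induces a transitive cyclic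
group on the edges at that vertex. -/
structure IsVertexRotary (Γ : IncGraph V E) : Prop where
  acts : ActsOnGraph A Γ
  arcTransitive : ArcTransitive A Γ
  cyclic : ∀ v, InducesCyclic (MulAction.stabilizer A v) {e | Γ.Inc v e}
  transitive : ∀ v e e', Γ.Inc v e → Γ.Inc v e' → ∃ g ∈ MulAction.stabilizer A v, g • e = e'

/-- Face-rotary: `A` is arc-transitive, and a face stabiliser induces a cyclic group on the edges
of that face. -/
structure IsFaceRotary (M : MapConfig V E F) : Prop where
  arcTransitive : ArcTransitive A M.toIncGraph
  cyclic : ∀ f, InducesCyclic (MulAction.stabilizer A f) {e | M.IncEF e f}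

/-- `A` is a group of automorphisms of `M`, both vertex-rotary and face-rotary. -/
structure IsRotary (M : MapConfig V E F) : Prop where
  acts : ActsOnMap A M
  vertexRotary : IsVertexRotary A M.toIncGraph
  faceRotary : IsFaceRotary A M

end

/-! ### Coset configurations -/

section

variable {G : Type u} [Group G]

/-- The set `[G : H]` of right cosets `H g`, as subsets of `G`. -/
def RightCosets (H : Subgroup G) : Type u :=
  {T : Set G // ∃ g : G, T = op g • (H : Set G)}

/-- The right coset `H g`. -/
def RightCosets.mk (H : Subgroup G) (g : G) : RightCosets H :=
  ⟨op g • (H : Set G), g, rfl⟩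

/-- The right multiplication action of `G` on `[G : H]`, as a left action of the opposite group:
`op g • T = T g`. -/
instance (H : Subgroup G) : MulAction Gᵐᵒᵖ (RightCosets H) where
  smul g T := ⟨g • T.1, by
    obtain ⟨x, hx⟩ := T.2
    exact ⟨x * g.unop, by rw [hx, smul_smul]; rfl⟩⟩
  one_smul T := Subtype.ext (one_smul Gᵐᵒᵖ T.1)
  mul_smul g h T := Subtype.ext (mul_smul g h T.1)

/-- The coset configuration `Cos(G, H, J, K)`: incidence is non-empty intersection. -/
def cosetConfig (H J K : Subgroup G) :
    IncConfig (RightCosets H) (RightCosets J) (RightCosets K) where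
  Inc v e := (v.1 ∩ e.1).Nonempty
  IncVF v f := (v.1 ∩ f.1).Nonempty
  IncEF e f := (e.1 ∩ f.1).Nonempty

/-- The conjugate `H ^ g = g⁻¹ H g`. -/
def conjSubgroup (H : Subgroup G) (g : G) : Subgroup G :=
  H.map (MulAut.conj g⁻¹).toMonoidHom

/-- `(a, z)` is a rotary pair for `G`. -/
structure IsRotaryPair (a z : G) : Prop where
  generates : Subgroup.closure {a, z} = ⊤
  finite_order : IsOfFinOrder a
  involution : orderOf z = 2
  notMem : z ∉ Subgroup.zpowers a

/-- The edge sequence `C(az) = (e₀, …, e_{m-1})` with `e_i = ⟨z⟩ (az)^i` and `m = |az|`. -/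
noncomputable def cycleSeq (a z : G) : List (RightCosets (Subgroup.zpowers z)) :=
  (List.range (orderOf (a * z))).map fun i =>
    RightCosets.mk (Subgroup.zpowers z) ((a * z) ^ i)

/-- The configuration `RotaMap(G, a, z)`: the coset configuration `Cos(G, ⟨a⟩, ⟨z⟩, ⟨az⟩)`, where
the images under `g` of the sequences in the class of `C(az)` are boundary sequences of the
face `⟨az⟩ g`, for each `g`. -/
def rotaMap (a z : G) :
    MapConfig (RightCosets (Subgroup.zpowers a)) (RightCosets (Subgroup.zpowers z))
      (RightCosets (Subgroup.zpowers (a * z))) where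
  toIncConfig := cosetConfig (Subgroup.zpowers a) (Subgroup.zpowers z) (Subgroup.zpowers (a * z))
  bdry f := {l | ∃ g : G, RightCosets.mk (Subgroup.zpowers (a * z)) g = f ∧
    ∃ c ∈ seqClass (cycleSeq a z), l = c.map (op g • ·)}

end

end RotaryMaps

open RotaryMaps

/-!
The pair `(a, z)` is a permutation-theoretic description of an oriented map: `G` is the set of
darts, left multiplication by `a` rotates the darts at a vertex, left multiplication by `z` reverses
a dart, and left multiplication by `az` moves a dart along its face. Vertices, edges and faces are
the orbits, that is, the right cosets of `⟨a⟩`, `⟨z⟩`, `⟨az⟩`, and `G` acts on the right, regularly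
on darts. Everything except the supporting surface is coset arithmetic.

*Combinatorics.* Two facts carry this part. The exponents `i` with `(az) ^ i ∈ ⟨a⟩` are the
multiples of `n = m / λ'`, and `n ≥ 3` because `z ∉ ⟨a⟩` and `⟨a⟩ ≠ ⟨a⟩ ^ z` (`exists_period`).
The subgroup `⟨a⟩ ∩ ⟨az⟩` is central (`commute_of_mem`), while `⟨a⟩ ∩ ⟨a⟩ ^ z` is normal
(`conj_mem_inf`), which gives the kernels. A boundary sequence of a face, in either direction, is
one period of a bi-infinite walk whose edges repeat with period `m` and whose vertices repeat with
period `n` (`exists_isPeriodicCycle`). Regularity, the isomorphism with the extender of the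
`n`-cycle, and the criterion for simplicity are then statements about such walks
(`IsPeriodicCycle`).

*The surface.* `Surf a z` is glued from unit squares, one for each edge, with corners alternately
at the ends of the edge and at the centres of the two adjacent faces; the edge is a diagonal. It is
convenient to take a square for each `g` in `G` and to identify the squares of `g` and `z g` by a
half-turn. Functions on the square that vanish on the two sides away from a corner, weighted by
suitable coefficients, descend to the quotient (`Surf.hat`). They yield the radial and planar
coordinates of a disc around each vertex, and functions supported on a single square. Reflecting
the squares identifies `Surf (az) z` with `Surf a z` and exchanges vertices with face centres
(`Surf.dual`), so that each fact about discs around vertices also holds for faces.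

Discs around vertices, discs around face centres and open squares cover the surface, and the
functions above separate points; so the surface is Hausdorff (`Surf.t2Space`). A continuous map
from a compact set into it that is injective over an open set is then open there
(`Surf.isOpenEmbedding_of_isCompact`), so the discs and squares are charts. In the polar
coordinates `x + y = r`, `y = r t` on the triangle at a corner, the boundary circle `r = 1` of a
face disc runs uniformly through the diagonals, as a 2-cell embedding requires
(`twoCellEmbedding`).
-/

namespace RotaryMaps

/-! ### Right cosets of cyclic subgroups -/

section

variable {G : Type u} [Group G]

lemma RightCosets.exists_mk {H : Subgroup G} (T : RightCosets H) : ∃ g, T = .mk H g := by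
  obtain ⟨_, g, rfl⟩ := T
  exact ⟨g, rfl⟩

lemma RightCosets.mem_mk {H : Subgroup G} {g x : G} : x ∈ (RightCosets.mk H g).1 ↔ x * g⁻¹ ∈ H :=
  mem_rightCoset_iff g

lemma RightCosets.mk_eq_mk {H : Subgroup G} {g h : G} :
    RightCosets.mk H g = .mk H h ↔ g * h⁻¹ ∈ H := by
  constructor
  · intro e
    rw [← mem_mk, ← e, mem_mk, mul_inv_cancel]
    exact one_mem H
  · intro e
    refine Subtype.ext (Set.ext fun x => ?_)
    rw [mem_mk, mem_mk, ← mul_mem_cancel_right e, mul_assoc, inv_mul_cancel_left]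

lemma RightCosets.op_smul_mk {H : Subgroup G} (g x : G) :
    op x • RightCosets.mk H g = .mk H (g * x) :=
  Subtype.ext (smul_smul (op x) (op g) (H : Set G))

/-- The right coset `⟨c⟩ g`. -/
abbrev coset (c g : G) : RightCosets (Subgroup.zpowers c) := .mk (Subgroup.zpowers c) g

lemma coset_eq_iff {c g h : G} : coset c g = coset c h ↔ g * h⁻¹ ∈ Subgroup.zpowers c :=
  RightCosets.mk_eq_mk

lemma coset_mul_of_mem {c x : G} (hx : x ∈ Subgroup.zpowers c) (g : G) :
    coset c (x * g) = coset c g := by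
  rwa [coset_eq_iff, mul_inv_cancel_right]

lemma coset_self_mul (c g : G) : coset c (c * g) = coset c g :=
  coset_mul_of_mem (Subgroup.mem_zpowers c) g

lemma coset_inter_nonempty {c d g h : G} : ((coset c g).1 ∩ (coset d h).1).Nonempty ↔
    ∃ x, coset c g = coset c x ∧ coset d h = coset d x := by
  refine exists_congr fun x => ?_
  rw [Set.mem_inter_iff, RightCosets.mem_mk, RightCosets.mem_mk, eq_comm, coset_eq_iff,
    eq_comm (a := coset d h), coset_eq_iff]

lemma smul_inter_nonempty_iff {H K : Subgroup G} (g : Gᵐᵒᵖ) (S : RightCosets H)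
    (T : RightCosets K) : ((g • S).1 ∩ (g • T).1).Nonempty ↔ (S.1 ∩ T.1).Nonempty := by
  change (g • S.1 ∩ g • T.1).Nonempty ↔ _
  rw [← Set.smul_set_inter, Set.smul_set_nonempty]

lemma mem_stabilizer_coset {c g : G} {x : Gᵐᵒᵖ} :
    x ∈ MulAction.stabilizer Gᵐᵒᵖ (coset c g) ↔ g * x.unop * g⁻¹ ∈ Subgroup.zpowers c := by
  rw [MulAction.mem_stabilizer_iff, ← MulOpposite.op_unop x, RightCosets.op_smul_mk, coset_eq_iff,
    MulOpposite.unop_op]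

lemma inducesCyclic_stabilizer_coset {E : Type*} [MulAction Gᵐᵒᵖ E] (c g : G) (X : Set E) :
    InducesCyclic (MulAction.stabilizer Gᵐᵒᵖ (coset c g)) X := by
  refine ⟨op (g⁻¹ * c * g), ?_, fun h hh => ?_⟩
  · rw [mem_stabilizer_coset]
    simp [mul_assoc]
  · obtain ⟨n, hn⟩ := Subgroup.mem_zpowers_iff.1 (mem_stabilizer_coset.1 hh)
    refine ⟨n, fun x _ => ?_⟩
    have h1 : h.unop = (g⁻¹ * c * g) ^ n := by
      have := conj_zpow (i := n) (a := g⁻¹) (b := c)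
      rw [inv_inv] at this
      rw [this, hn]
      group
    rw [← MulOpposite.op_unop h, h1, MulOpposite.op_zpow]

lemma mem_conjSubgroup {H : Subgroup G} {g x : G} : x ∈ conjSubgroup H g ↔ g * x * g⁻¹ ∈ H := by
  constructor
  · rintro ⟨y, hy, rfl⟩
    simpa [mul_assoc] using hy
  · intro h
    exact ⟨_, h, by simp [mul_assoc]⟩

lemma conjSubgroup_zpowers (a g : G) :
    conjSubgroup (Subgroup.zpowers a) g = Subgroup.zpowers (g⁻¹ * a * g) := by
  rw [conjSubgroup, MonoidHom.map_zpowers]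
  simp

lemma mem_zpowers_involution {z : G} (hz : z * z = 1) {x : G} :
    x ∈ Subgroup.zpowers z ↔ x = 1 ∨ x = z := by
  constructor
  · rintro ⟨n, rfl⟩
    rcases Int.even_or_odd' n with ⟨k, rfl | rfl⟩
    · left
      simp only [zpow_mul, zpow_two, hz, one_zpow]
    · right
      simp only [zpow_add, zpow_mul, zpow_two, hz, one_zpow, one_mul, zpow_one]
  · rintro (rfl | rfl)
    · exact one_mem _
    · exact Subgroup.mem_zpowers _

lemma coset_involution_eq_iff {z : G} (hz : z * z = 1) {g h : G} :
    coset z g = coset z h ↔ g = h ∨ g = z * h := by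
  rw [coset_eq_iff, mem_zpowers_involution hz, mul_inv_eq_one, mul_inv_eq_iff_eq_mul]

/-! ### Incidences -/

variable {a z : G}

lemma IsRotaryPair.mul_self (hp : IsRotaryPair a z) : z * z = 1 := by
  rw [← pow_two, ← hp.involution, pow_orderOf_eq_one]

lemma IsRotaryPair.ne_one (hp : IsRotaryPair a z) : z ≠ 1 := by
  rintro rfl
  exact hp.notMem (one_mem _)

lemma IsRotaryPair.inv_eq (hp : IsRotaryPair a z) : z⁻¹ = z :=
  inv_eq_of_mul_eq_one_left hp.mul_self

lemma IsRotaryPair.finite_zpowers (hp : IsRotaryPair a z) : Finite (Subgroup.zpowers a) :=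
  Nat.finite_of_card_ne_zero (by rw [Nat.card_zpowers]; exact hp.finite_order.orderOf_pos.ne')

lemma inc_iff_exists {v : RightCosets (Subgroup.zpowers a)} {e : RightCosets (Subgroup.zpowers z)} :
    (rotaMap a z).Inc v e ↔ ∃ g, v = coset a g ∧ e = coset z g := by
  obtain ⟨g, rfl⟩ := v.exists_mk
  obtain ⟨h, rfl⟩ := e.exists_mk
  exact coset_inter_nonempty

lemma inc_coset_iff (hz : z * z = 1) {v : RightCosets (Subgroup.zpowers a)} {g : G} :
    (rotaMap a z).Inc v (coset z g) ↔ v = coset a g ∨ v = coset a (z * g) := by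
  rw [inc_iff_exists]
  simp only [coset_involution_eq_iff hz]
  constructor
  · rintro ⟨x, rfl, rfl | rfl⟩
    · exact .inl rfl
    · right
      rw [← mul_assoc, hz, one_mul]
  · rintro (rfl | rfl)
    · exact ⟨_, rfl, .inl rfl⟩
    · exact ⟨_, rfl, .inr (by rw [← mul_assoc, hz, one_mul])⟩

lemma incEF_coset_iff (hz : z * z = 1) {f : RightCosets (Subgroup.zpowers (a * z))} {g : G} :
    (rotaMap a z).IncEF (coset z g) f ↔ f = coset (a * z) g ∨ f = coset (a * z) (z * g) := by
  obtain ⟨k, rfl⟩ := f.exists_mk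
  refine coset_inter_nonempty.trans ?_
  simp only [coset_involution_eq_iff hz]
  constructor
  · rintro ⟨x, rfl | rfl, h⟩
    · exact .inl h
    · right
      rwa [← mul_assoc, hz, one_mul]
  · rintro (h | h)
    · exact ⟨_, .inl rfl, h⟩
    · exact ⟨_, .inr (by rw [← mul_assoc, hz, one_mul]), h⟩

lemma incVF_coset_iff {h k : G} : (rotaMap a z).IncVF (coset a h) (coset (a * z) k) ↔
    ∃ x, coset a h = coset a x ∧ coset (a * z) k = coset (a * z) x :=
  coset_inter_nonempty

/-! ### Consequences of `⟨a⟩ ≠ ⟨a⟩ ^ z` -/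

lemma conj_notMem (hp : IsRotaryPair a z)
    (hne : Subgroup.zpowers a ≠ conjSubgroup (Subgroup.zpowers a) z) :
    z * a * z ∉ Subgroup.zpowers a := by
  intro h
  have hz := hp.mul_self
  rw [conjSubgroup_zpowers, hp.inv_eq] at hne
  refine hne (le_antisymm ?_ ((Subgroup.zpowers_le).2 h))
  rw [Subgroup.zpowers_le]
  obtain ⟨j, hj⟩ := h
  refine ⟨j, ?_⟩
  have h1 : (z * a * z) ^ j = z * a ^ j * z := by
    have := conj_zpow (i := j) (a := z) (b := a)
    rwa [hp.inv_eq] at this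
  simp only at hj ⊢
  rw [h1, hj]
  simp only [mul_assoc, hz, mul_one]
  rw [← mul_assoc, hz, one_mul]

lemma notMem_zpowers_mul (hp : IsRotaryPair a z)
    (hne : Subgroup.zpowers a ≠ conjSubgroup (Subgroup.zpowers a) z) :
    z ∉ Subgroup.zpowers (a * z) := by
  intro h
  have hz := hp.mul_self
  have hcomm : Commute (a * z) z := by
    obtain ⟨j, hj⟩ := Subgroup.mem_zpowers_iff.1 h
    have := (Commute.refl (a * z)).zpow_right j
    rwa [hj] at this
  refine conj_notMem hp hne ?_
  rw [mul_assoc, ← hcomm.eq, mul_assoc, hz, mul_one]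
  exact Subgroup.mem_zpowers a

lemma commute_of_mem (hp : IsRotaryPair a z) {c : G}
    (hc : c ∈ Subgroup.zpowers a ⊓ Subgroup.zpowers (a * z)) (g : G) : Commute g c := by
  have key : ∀ b, c ∈ Subgroup.zpowers b → Commute b c := by
    rintro b ⟨j, rfl⟩
    exact (Commute.refl b).zpow_right j
  have ha := key _ hc.1
  have hz : Commute z c := by
    have := ha.inv_left.mul_left (key _ hc.2)
    rwa [inv_mul_cancel_left] at this
  have : g ∈ Subgroup.closure {a, z} := hp.generates ▸ Subgroup.mem_top g
  induction this using Subgroup.closure_induction with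
  | mem x hx =>
    rcases hx with rfl | rfl
    exacts [ha, hz]
  | one => exact Commute.one_left c
  | mul x y _ _ hx hy => exact hx.mul_left hy
  | inv x _ hx => exact hx.inv_left

lemma inf_le_conj (hp : IsRotaryPair a z) :
    Subgroup.zpowers a ⊓ Subgroup.zpowers (a * z) ≤
      Subgroup.zpowers a ⊓ conjSubgroup (Subgroup.zpowers a) z := by
  intro c hc
  refine ⟨hc.1, mem_conjSubgroup.2 ?_⟩
  rw [(commute_of_mem hp hc z).eq, mul_inv_cancel_right]
  exact hc.1

/-- The subgroup `⟨a⟩ ∩ ⟨a⟩ ^ z` is normal, as it is centralized by `a` and normalized by `z`. -/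
lemma conj_mem_inf (hp : IsRotaryPair a z) {x : G}
    (hx : x ∈ Subgroup.zpowers a ⊓ conjSubgroup (Subgroup.zpowers a) z) (g : G) :
    g * x * g⁻¹ ∈ Subgroup.zpowers a ⊓ conjSubgroup (Subgroup.zpowers a) z := by
  have hA : ∀ x ∈ Subgroup.zpowers a ⊓ conjSubgroup (Subgroup.zpowers a) z, Commute a x := by
    rintro _ ⟨⟨j, rfl⟩, -⟩
    exact (Commute.refl a).zpow_right j
  have hZ : ∀ x ∈ Subgroup.zpowers a ⊓ conjSubgroup (Subgroup.zpowers a) z,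
      z * x * z⁻¹ ∈ Subgroup.zpowers a ⊓ conjSubgroup (Subgroup.zpowers a) z := by
    intro x hx
    refine ⟨mem_conjSubgroup.1 hx.2, mem_conjSubgroup.2 ?_⟩
    rw [hp.inv_eq, ← mul_assoc, ← mul_assoc, hp.mul_self, one_mul, mul_assoc, hp.mul_self, mul_one]
    exact hx.1
  have : g ∈ Subgroup.closure {a, z} := hp.generates ▸ Subgroup.mem_top g
  induction this using Subgroup.closure_induction_left with
  | one => simpa using hx
  | mul_left y hy g _ ih =>
    have h : y * g * x * (y * g)⁻¹ = y * (g * x * g⁻¹) * y⁻¹ := by group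
    rw [h]
    rcases hy with rfl | rfl
    · rwa [(hA _ ih).eq, mul_inv_cancel_right]
    · exact hZ _ ih
  | inv_mul_cancel y hy g _ ih =>
    have h : y⁻¹ * g * x * (y⁻¹ * g)⁻¹ = y⁻¹ * (g * x * g⁻¹) * y⁻¹⁻¹ := by group
    rw [h]
    rcases hy with rfl | rfl
    · rwa [(hA _ ih).inv_left.eq, mul_inv_cancel_right]
    · rw [hp.inv_eq]
      exact hZ _ ih

/-- The exponents `i` with `(az) ^ i` in `⟨a⟩` are the multiples of some `n ≥ 3`. -/
lemma exists_period (hp : IsRotaryPair a z)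
    (hne : Subgroup.zpowers a ≠ conjSubgroup (Subgroup.zpowers a) z) (hm : IsOfFinOrder (a * z)) :
    ∃ n : ℕ, 3 ≤ n ∧ (∀ i : ℤ, (a * z) ^ i ∈ Subgroup.zpowers a ↔ (n : ℤ) ∣ i) ∧
      n * Nat.card ↥(Subgroup.zpowers a ⊓ Subgroup.zpowers (a * z)) = orderOf (a * z) := by
  have hz := hp.mul_self
  obtain ⟨n, hn⟩ : ∃ n : ℕ, ∀ i : ℤ, (a * z) ^ i ∈ Subgroup.zpowers a ↔ (n : ℤ) ∣ i := by
    refine ⟨Function.minimalPeriod ((a * z) • ·) ((1 : G) : G ⧸ Subgroup.zpowers a), fun i => ?_⟩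
    rw [← MulAction.zpow_smul_eq_iff_minimalPeriod_dvd, MulAction.Quotient.smul_coe, smul_eq_mul,
      mul_one, eq_comm, QuotientGroup.eq, inv_one, one_mul]
  have hnm : n ∣ orderOf (a * z) := by
    rw [← Int.natCast_dvd_natCast, ← hn, zpow_natCast, pow_orderOf_eq_one]
    exact one_mem _
  have hn0 : n ≠ 0 := by
    rintro rfl
    exact hm.orderOf_pos.ne' (zero_dvd_iff.1 hnm)
  refine ⟨n, ?_, hn, ?_⟩
  · have h1 : n ≠ 1 := by
      rintro rfl
      have := (hn 1).2 (by norm_num)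
      rw [zpow_one, Subgroup.mul_mem_cancel_left _ (Subgroup.mem_zpowers a)] at this
      exact hp.notMem this
    have h2 : n ≠ 2 := by
      rintro rfl
      have := (hn 2).2 (by norm_num)
      rw [zpow_two, mul_assoc, Subgroup.mul_mem_cancel_left _ (Subgroup.mem_zpowers a),
        ← mul_assoc] at this
      exact conj_notMem hp hne this
    omega
  · have : Subgroup.zpowers a ⊓ Subgroup.zpowers (a * z) = Subgroup.zpowers ((a * z) ^ n) := by
      refine le_antisymm ?_ ?_
      · rintro _ ⟨h, j, rfl⟩
        obtain ⟨i, rfl⟩ := (hn j).1 h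
        exact ⟨i, by simp [zpow_mul]⟩
      · rw [Subgroup.zpowers_le]
        refine ⟨?_, Subgroup.pow_mem _ (Subgroup.mem_zpowers _) n⟩
        have := (hn n).2 dvd_rfl
        rwa [zpow_natCast] at this
    rw [this, Nat.card_zpowers, orderOf_pow_of_dvd hn0 hnm, Nat.mul_div_cancel' hnm]

end

/-! ### Periodic cycles -/

section

variable {V E : Type*}

/-- A bi-infinite walk in the graph `Γ` with the edges `e i` joining `α i` and `α (i + 1)`, in which
edges repeat exactly with period `m` and vertices exactly with period `n`. Running once through it
gives a regular cycle. -/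
structure IsPeriodicCycle (Γ : IncGraph V E) (α : ℤ → V) (e : ℤ → E) (n m : ℕ) : Prop where
  inc_iff : ∀ i v, Γ.Inc v (e i) ↔ v = α i ∨ v = α (i + 1)
  edge_eq_iff : ∀ i j, e i = e j ↔ (m : ℤ) ∣ i - j
  vertex_eq_iff : ∀ i j, α i = α j ↔ (n : ℤ) ∣ i - j
  three_le : 3 ≤ n
  dvd : n ∣ m
  ne_zero : m ≠ 0

namespace IsPeriodicCycle

variable {Γ : IncGraph V E} {α : ℤ → V} {e : ℤ → E} {n m : ℕ}

/-- The finite list of edges of one period. -/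
def list (e : ℤ → E) (m : ℕ) : List E := (List.range m).map fun i : ℕ => e i

lemma length_list (e : ℤ → E) (m : ℕ) : (list e m).length = m := by simp [list]

lemma reverse (h : IsPeriodicCycle Γ α e n m) :
    IsPeriodicCycle Γ (fun i => α (-i)) (fun i => e (-1 - i)) n m where
  inc_iff i v := by
    rw [h.inc_iff, or_comm]
    ring_nf
  edge_eq_iff i j := by
    rw [h.edge_eq_iff, ← dvd_neg]
    ring_nf
  vertex_eq_iff i j := by
    rw [h.vertex_eq_iff, ← dvd_neg]
    ring_nf
  three_le := h.three_le
  dvd := h.dvd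
  ne_zero := h.ne_zero

lemma list_reverse (h : IsPeriodicCycle Γ α e n m) :
    (list e m).reverse = list (fun i => e (-1 - i)) m := by
  refine List.ext_getElem (by simp [list]) fun i h1 h2 => ?_
  rw [length_list] at h2
  simp only [list, List.getElem_reverse, List.getElem_map, List.getElem_range, List.length_map,
    List.length_range]
  rw [h.edge_eq_iff]
  refine ⟨1, ?_⟩
  omega

lemma exists_nat_lt {n : ℕ} (hn : n ≠ 0) (i : ℤ) : ∃ k : ℕ, k < n ∧ (n : ℤ) ∣ k - i := by
  have hn' : (0 : ℤ) < n := by omega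
  have h0 := Int.emod_nonneg i hn'.ne'
  have h1 := Int.emod_lt_of_pos i hn'
  refine ⟨(i % n).toNat, by omega, -(i / n), ?_⟩
  rw [Int.toNat_of_nonneg h0]
  have := Int.emod_add_mul_ediv i n
  linarith

lemma mem_list_iff (h : IsPeriodicCycle Γ α e n m) {x : E} : x ∈ list e m ↔ ∃ i, x = e i := by
  constructor
  · intro hx
    obtain ⟨i, -, rfl⟩ := List.mem_map.1 hx
    exact ⟨_, rfl⟩
  · rintro ⟨i, rfl⟩
    obtain ⟨k, hk, hd⟩ := exists_nat_lt h.ne_zero i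
    exact List.mem_map.2 ⟨k, List.mem_range.2 hk, (h.edge_eq_iff _ _).2 hd⟩

lemma three_le' (h : IsPeriodicCycle Γ α e n m) : 3 ≤ m :=
  h.three_le.trans (Nat.le_of_dvd (Nat.pos_of_ne_zero h.ne_zero) h.dvd)

lemma eq_of_dvd_sub {m i j : ℕ} (hi : i < m) (hj : j < m) (h : (m : ℤ) ∣ i - j) : i = j := by
  have h0 := Int.eq_zero_of_abs_lt_dvd h (by rw [abs_lt]; omega)
  omega

lemma nodup_list (h : IsPeriodicCycle Γ α e n m) : (list e m).Nodup := by
  refine List.Nodup.map_on (fun i hi j hj hij => ?_) List.nodup_range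
  rw [List.mem_range] at hi hj
  exact eq_of_dvd_sub hi hj ((h.edge_eq_iff _ _).1 hij)

lemma isCycleThrough (h : IsPeriodicCycle Γ α e n m) :
    Γ.IsCycleThrough (list e m) fun i => α i where
  three_le := by
    rw [length_list]
    exact h.three_le'
  nodup := h.nodup_list
  periodic i := by
    rw [length_list, h.vertex_eq_iff]
    simpa using Int.natCast_dvd_natCast.2 h.dvd
  ends_ne i := by
    rw [Ne, h.vertex_eq_iff]
    intro hd
    have := Int.eq_zero_of_abs_lt_dvd hd (by have := h.three_le; rw [abs_lt]; omega)
    omega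
  ends i hi v := by
    simpa [list] using h.inc_iff i v

lemma encard_range (h : IsPeriodicCycle Γ α e n m) : (Set.range α).encard = n := by
  have hn : n ≠ 0 := by have := h.three_le; omega
  have : Set.range α = (fun i : ℕ => α i) '' (Finset.range n : Finset ℕ) := by
    ext v
    constructor
    · rintro ⟨i, rfl⟩
      obtain ⟨k, hk, hd⟩ := exists_nat_lt hn i
      exact ⟨k, by simpa using hk, (h.vertex_eq_iff _ _).2 hd⟩
    · rintro ⟨i, -, rfl⟩
      exact ⟨i, rfl⟩
  rw [this, Set.InjOn.encard_image, Set.encard_coe_eq_coe_finsetCard, Finset.card_range]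
  intro i hi j hj hij
  rw [Finset.coe_range, Set.mem_Iio] at hi hj
  exact eq_of_dvd_sub hi hj ((h.vertex_eq_iff _ _).1 hij)

lemma range_natCast (h : IsPeriodicCycle Γ α e n m) :
    Set.range (fun i : ℕ => α i) = Set.range α := by
  refine subset_antisymm (by rintro _ ⟨i, rfl⟩; exact ⟨i, rfl⟩) ?_
  rintro _ ⟨i, rfl⟩
  obtain ⟨k, -, hd⟩ := exists_nat_lt (n := n) (by have := h.three_le; omega) i
  exact ⟨k, (h.vertex_eq_iff _ _).2 hd⟩

lemma isRegularCycle (h : IsPeriodicCycle Γ α e n m) : Γ.IsRegularCycle (list e m) := by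
  refine ⟨_, n, m / n, h.isCycleThrough, ?_, ?_, fun i => ?_⟩
  · rw [length_list, Nat.mul_div_cancel' h.dvd]
  · rw [h.range_natCast, h.encard_range]
  · rw [h.vertex_eq_iff]
    simp

lemma exists_mem_list_inc_iff (h : IsPeriodicCycle Γ α e n m) {v : V} :
    (∃ x ∈ list e m, Γ.Inc v x) ↔ v ∈ Set.range α := by
  constructor
  · rintro ⟨x, hx, hv⟩
    obtain ⟨i, rfl⟩ := h.mem_list_iff.1 hx
    rcases (h.inc_iff i v).1 hv with rfl | rfl <;> exact ⟨_, rfl⟩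
  · rintro ⟨i, rfl⟩
    exact ⟨e i, h.mem_list_iff.2 ⟨i, rfl⟩, (h.inc_iff _ _).2 (.inl rfl)⟩

lemma isSimpleCycle_iff (h : IsPeriodicCycle Γ α e n m) :
    Γ.IsSimpleCycle (list e m) ↔ n = m := by
  constructor
  · rintro ⟨β, hβ, hinj⟩
    rw [length_list] at hinj
    refine le_antisymm (Nat.le_of_dvd (Nat.pos_of_ne_zero h.ne_zero) h.dvd) ?_
    -- the `m` distinct vertices of the cycle lie among the `n` values of `α`
    have hsub : β '' (Finset.range m : Finset ℕ) ⊆ Set.range α := by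
      rintro _ ⟨i, hi, rfl⟩
      rw [Finset.coe_range, Set.mem_Iio] at hi
      have hi' : i < (list e m).length := by rwa [length_list]
      exact h.exists_mem_list_inc_iff.1
        ⟨_, List.getElem_mem hi', (hβ.ends i hi' _).2 (.inl rfl)⟩
    have hc := Set.encard_le_encard hsub
    rw [h.encard_range, Set.InjOn.encard_image, Set.encard_coe_eq_coe_finsetCard,
      Finset.card_range] at hc
    · exact_mod_cast hc
    · intro i hi j hj hij
      rw [Finset.coe_range, Set.mem_Iio] at hi hj
      exact hinj i hi j hj hij
  · rintro rfl
    refine ⟨_, h.isCycleThrough, fun i hi j hj hij => ?_⟩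
    rw [length_list] at hi hj
    exact eq_of_dvd_sub hi hj ((h.vertex_eq_iff _ _).1 hij)

lemma nonempty_iso (h : IsPeriodicCycle Γ α e n m) {μ : ℕ} (hμ : m = n * μ) :
    Nonempty ((Γ.edgeInduced {x | x ∈ list e m}).Iso ((cycleGraph n).extender μ)) := by
  have : NeZero n := ⟨by have := h.three_le; omega⟩
  have hα : ∀ i (r : ZMod n), α i = α r.val ↔ (i : ZMod n) = r := by
    intro i r
    rw [h.vertex_eq_iff, ← ZMod.intCast_zmod_eq_zero_iff_dvd]
    push_cast
    rw [ZMod.natCast_rightInverse r, sub_eq_zero]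
  let fV : ZMod n → {v : V // ∃ x ∈ {x | x ∈ list e m}, Γ.Inc v x} := fun r =>
    ⟨α r.val, h.exists_mem_list_inc_iff.2 ⟨_, rfl⟩⟩
  have hV : Function.Bijective fV := by
    constructor
    · intro r s hrs
      have := (hα _ _).1 (congrArg Subtype.val hrs)
      rwa [Int.cast_natCast, ZMod.natCast_rightInverse r] at this
    · rintro ⟨v, hv⟩
      obtain ⟨i, rfl⟩ := h.exists_mem_list_inc_iff.1 hv
      exact ⟨i, Subtype.ext ((hα i i).2 rfl).symm⟩
  let fE : ZMod n × Fin μ → {x : E // x ∈ {x | x ∈ list e m}} := fun p =>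
    ⟨e ((p.1.val + n * p.2.val : ℕ) : ℤ), h.mem_list_iff.2 ⟨_, rfl⟩⟩
  have hlt : ∀ p : ZMod n × Fin μ, p.1.val + n * p.2.val < m := by
    rintro ⟨r, q⟩
    have h1 := ZMod.val_lt r
    have h2 : n * (q.val + 1) ≤ n * μ := Nat.mul_le_mul_left n q.2
    simp only
    rw [mul_add, mul_one] at h2
    omega
  have hE : Function.Bijective fE := by
    constructor
    · intro p q hpq
      have := eq_of_dvd_sub (hlt p) (hlt q) ((h.edge_eq_iff _ _).1 (congrArg Subtype.val hpq))
      obtain ⟨r, i⟩ := p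
      obtain ⟨s, j⟩ := q
      simp only at this
      have hr := congrArg (· % n) this
      have hi := congrArg (· / n) this
      simp only [Nat.add_mul_mod_self_left, Nat.mod_eq_of_lt (ZMod.val_lt _)] at hr
      simp only [Nat.add_mul_div_left _ _ (NeZero.pos n), Nat.div_eq_of_lt (ZMod.val_lt _),
        zero_add] at hi
      rw [ZMod.val_injective n hr, Fin.ext hi]
    · rintro ⟨x, hx⟩
      obtain ⟨i, hi, rfl⟩ := List.mem_map.1 hx
      rw [List.mem_range, hμ] at hi
      refine ⟨⟨i, ⟨i / n, Nat.div_lt_of_lt_mul hi⟩⟩, Subtype.ext ?_⟩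
      change e ((((i : ZMod n).val + n * (i / n) : ℕ) : ℕ) : ℤ) = e i
      rw [ZMod.val_natCast, Nat.mod_add_div]
  refine ⟨⟨(Equiv.ofBijective fV hV).symm, (Equiv.ofBijective fE hE).symm, fun v x => ?_⟩⟩
  obtain ⟨r, rfl⟩ := hV.surjective v
  obtain ⟨⟨s, q⟩, rfl⟩ := hE.surjective x
  rw [Equiv.ofBijective_symm_apply_apply, Equiv.ofBijective_symm_apply_apply]
  change r = s ∨ r = s + 1 ↔ Γ.Inc (α r.val) (e _)
  rw [h.inc_iff, eq_comm (a := α _), hα, eq_comm (a := α _), hα]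
  push_cast
  rw [ZMod.natCast_rightInverse s, ZMod.natCast_self, zero_mul, add_zero, eq_comm,
    eq_comm (a := r)]

end IsPeriodicCycle

end

section

variable {G : Type u} [Group G] {a z : G}

/-! ### Boundary cycles -/

/-- The image of the edge sequence `C(az)` under `g`. -/
noncomputable def edgeSeq (a z g : G) : List (RightCosets (Subgroup.zpowers z)) :=
  (List.range (orderOf (a * z))).map fun i => coset z ((a * z) ^ i * g)

lemma length_edgeSeq (g : G) : (edgeSeq a z g).length = orderOf (a * z) := by
  simp [edgeSeq]

lemma getElem_edgeSeq (g : G) (i : ℕ) (hi : i < (edgeSeq a z g).length) :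
    (edgeSeq a z g)[i] = coset z ((a * z) ^ i * g) := by
  simp [edgeSeq]

lemma edgeSeq_one : edgeSeq a z 1 = cycleSeq a z := by
  simp [edgeSeq, cycleSeq]

lemma map_edgeSeq (g x : G) : (edgeSeq a z g).map (op x • ·) = edgeSeq a z (g * x) := by
  simp [edgeSeq, RightCosets.op_smul_mk, mul_assoc]

lemma rotate_edgeSeq (g : G) (i : ℕ) :
    (edgeSeq a z g).rotate i = edgeSeq a z ((a * z) ^ i * g) := by
  refine List.ext_getElem (by simp [length_edgeSeq]) fun k h1 h2 => ?_
  rw [List.getElem_rotate, getElem_edgeSeq, getElem_edgeSeq, length_edgeSeq, pow_mod_orderOf,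
    pow_add, mul_assoc]

lemma mem_seqClass_edgeSeq {g : G} {c : List (RightCosets (Subgroup.zpowers z))} :
    c ∈ seqClass (edgeSeq a z g) ↔
      ∃ i : ℕ, c = edgeSeq a z ((a * z) ^ i * g) ∨ c = (edgeSeq a z ((a * z) ^ i * g)).reverse := by
  simp only [seqClass, Set.mem_ofPred_eq, exists_or]
  refine or_congr ?_ ?_
  · rw [List.isRotated_comm]
    refine exists_congr fun i => ?_
    rw [rotate_edgeSeq, eq_comm]
  · rw [← List.isRotated_reverse_comm_iff, List.isRotated_comm]
    refine exists_congr fun i => ?_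
    rw [rotate_edgeSeq, eq_comm, List.reverse_eq_iff]

lemma bdry_coset (hm : IsOfFinOrder (a * z)) (g : G) :
    (rotaMap a z).bdry (coset (a * z) g) = seqClass (edgeSeq a z g) := by
  ext l
  rw [mem_seqClass_edgeSeq]
  constructor
  · rintro ⟨g', hg', c, hc, rfl⟩
    rw [← edgeSeq_one, mem_seqClass_edgeSeq] at hc
    rw [coset_eq_iff, ← hm.mem_powers_iff_mem_zpowers] at hg'
    obtain ⟨j, hj⟩ := hg'
    have hj' : g' = (a * z) ^ j * g := eq_mul_of_mul_inv_eq hj.symm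
    obtain ⟨i, rfl | rfl⟩ := hc
    · refine ⟨i + j, .inl ?_⟩
      rw [map_edgeSeq, mul_one, hj', pow_add, mul_assoc]
    · refine ⟨i + j, .inr ?_⟩
      rw [List.map_reverse, map_edgeSeq, mul_one, hj', pow_add, mul_assoc]
  · rintro ⟨i, hi⟩
    rw [← map_edgeSeq ((a * z) ^ i) g, ← List.map_reverse] at hi
    rcases hi with rfl | rfl
    · refine ⟨g, rfl, _, ?_, rfl⟩
      rw [← edgeSeq_one, mem_seqClass_edgeSeq]
      exact ⟨i, .inl (by rw [mul_one])⟩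
    · refine ⟨g, rfl, _, ?_, rfl⟩
      rw [← edgeSeq_one, mem_seqClass_edgeSeq]
      exact ⟨i, .inr (by rw [mul_one])⟩

lemma bdry_smul (hm : IsOfFinOrder (a * z)) (g : Gᵐᵒᵖ)
    (f : RightCosets (Subgroup.zpowers (a * z))) :
    (rotaMap a z).bdry (g • f) = List.map (g • ·) '' (rotaMap a z).bdry f := by
  obtain ⟨x, rfl⟩ := f.exists_mk
  rw [← MulOpposite.op_unop g, RightCosets.op_smul_mk, bdry_coset hm, bdry_coset hm]
  ext l
  simp only [Set.mem_image, mem_seqClass_edgeSeq]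
  constructor
  · rintro ⟨i, rfl | rfl⟩
    · exact ⟨_, ⟨i, .inl rfl⟩, by rw [map_edgeSeq, mul_assoc]⟩
    · exact ⟨_, ⟨i, .inr rfl⟩, by rw [List.map_reverse, map_edgeSeq, mul_assoc]⟩
  · rintro ⟨_, ⟨i, rfl | rfl⟩, rfl⟩
    · exact ⟨i, .inl (by rw [map_edgeSeq, mul_assoc])⟩
    · exact ⟨i, .inr (by rw [List.map_reverse, map_edgeSeq, mul_assoc])⟩

lemma isPeriodicCycle (hp : IsRotaryPair a z)
    (hne : Subgroup.zpowers a ≠ conjSubgroup (Subgroup.zpowers a) z) (hm : IsOfFinOrder (a * z))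
    {n : ℕ} (h3 : 3 ≤ n) (hn : ∀ i : ℤ, (a * z) ^ i ∈ Subgroup.zpowers a ↔ (n : ℤ) ∣ i) (g : G) :
    IsPeriodicCycle (rotaMap a z).toIncGraph (fun i : ℤ => coset a ((a * z) ^ i * g))
      (fun i : ℤ => coset z ((a * z) ^ i * g)) n (orderOf (a * z)) where
  inc_iff i v := by
    rw [inc_coset_iff hp.mul_self, add_comm, zpow_add, zpow_one, mul_assoc, mul_assoc,
      coset_self_mul]
  edge_eq_iff i j := by
    rw [coset_eq_iff, mul_inv_rev, mul_assoc, mul_inv_cancel_left, ← zpow_sub,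
      mem_zpowers_involution hp.mul_self, ← orderOf_dvd_iff_zpow_eq_one, or_iff_left]
    exact fun h => notMem_zpowers_mul hp hne ⟨_, h⟩
  vertex_eq_iff i j := by
    rw [coset_eq_iff, mul_inv_rev, mul_assoc, mul_inv_cancel_left, ← zpow_sub, hn]
  three_le := h3
  dvd := by
    rw [← Int.natCast_dvd_natCast, ← hn, zpow_natCast, pow_orderOf_eq_one]
    exact one_mem _
  ne_zero := hm.orderOf_pos.ne'

lemma edgeSeq_eq_list (g : G) : edgeSeq a z g =
    IsPeriodicCycle.list (fun i : ℤ => coset z ((a * z) ^ i * g)) (orderOf (a * z)) := by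
  simp [edgeSeq, IsPeriodicCycle.list]

/-- Every boundary sequence is one period of a periodic cycle through the edges of the face. -/
lemma exists_isPeriodicCycle (hp : IsRotaryPair a z)
    (hne : Subgroup.zpowers a ≠ conjSubgroup (Subgroup.zpowers a) z) (hm : IsOfFinOrder (a * z))
    {n : ℕ} (h3 : 3 ≤ n) (hn : ∀ i : ℤ, (a * z) ^ i ∈ Subgroup.zpowers a ↔ (n : ℤ) ∣ i) {g : G}
    {l : List (RightCosets (Subgroup.zpowers z))}
    (hl : l ∈ (rotaMap a z).bdry (coset (a * z) g)) :
    ∃ α e, IsPeriodicCycle (rotaMap a z).toIncGraph α e n (orderOf (a * z)) ∧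
      l = IsPeriodicCycle.list e (orderOf (a * z)) ∧
      ∀ x, x ∈ l ↔ ∃ h, coset (a * z) h = coset (a * z) g ∧ x = coset z h := by
  rw [bdry_coset hm, mem_seqClass_edgeSeq] at hl
  obtain ⟨i, hl⟩ := hl
  have h := isPeriodicCycle hp hne hm h3 hn ((a * z) ^ i * g)
  have hmem : ∀ x, x ∈ edgeSeq a z ((a * z) ^ i * g) ↔
      ∃ h, coset (a * z) h = coset (a * z) g ∧ x = coset z h := by
    intro x
    rw [edgeSeq_eq_list, h.mem_list_iff]
    constructor
    · rintro ⟨j, rfl⟩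
      refine ⟨_, ?_, rfl⟩
      rw [coset_mul_of_mem (Subgroup.zpow_mem_zpowers _ _),
        coset_mul_of_mem (Subgroup.npow_mem_zpowers _ _)]
    · rintro ⟨y, hy, rfl⟩
      obtain ⟨j, hj⟩ := Subgroup.mem_zpowers_iff.1 (coset_eq_iff.1 hy)
      refine ⟨j - i, ?_⟩
      rw [← mul_assoc, ← zpow_natCast, ← zpow_add, sub_add_cancel, hj, inv_mul_cancel_right]
  rcases hl with rfl | rfl
  · exact ⟨_, _, h, edgeSeq_eq_list _, hmem⟩
  · refine ⟨_, _, h.reverse, ?_, fun x => ?_⟩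
    · rw [← h.list_reverse, edgeSeq_eq_list]
    · rw [List.mem_reverse, hmem]

lemma incEF_iff_mem (hp : IsRotaryPair a z)
    (hne : Subgroup.zpowers a ≠ conjSubgroup (Subgroup.zpowers a) z) (hm : IsOfFinOrder (a * z))
    {f : RightCosets (Subgroup.zpowers (a * z))} {l : List (RightCosets (Subgroup.zpowers z))}
    (hl : l ∈ (rotaMap a z).bdry f) (e : RightCosets (Subgroup.zpowers z)) :
    (rotaMap a z).IncEF e f ↔ e ∈ l := by
  obtain ⟨g, rfl⟩ := f.exists_mk
  obtain ⟨n, h3, hn, -⟩ := exists_period hp hne hm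
  obtain ⟨-, -, -, -, h⟩ := exists_isPeriodicCycle hp hne hm h3 hn hl
  obtain ⟨y, rfl⟩ := e.exists_mk
  rw [h]
  refine coset_inter_nonempty.trans (exists_congr fun x => ?_)
  rw [and_comm, eq_comm]

lemma incVF_iff_exists_mem (hp : IsRotaryPair a z)
    (hne : Subgroup.zpowers a ≠ conjSubgroup (Subgroup.zpowers a) z) (hm : IsOfFinOrder (a * z))
    {f : RightCosets (Subgroup.zpowers (a * z))} {l : List (RightCosets (Subgroup.zpowers z))}
    (hl : l ∈ (rotaMap a z).bdry f) (v : RightCosets (Subgroup.zpowers a)) :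
    (rotaMap a z).IncVF v f ↔ ∃ e ∈ l, (rotaMap a z).Inc v e := by
  obtain ⟨g, rfl⟩ := f.exists_mk
  obtain ⟨n, h3, hn, -⟩ := exists_period hp hne hm
  obtain ⟨-, -, -, -, h⟩ := exists_isPeriodicCycle hp hne hm h3 hn hl
  obtain ⟨y, rfl⟩ := v.exists_mk
  rw [incVF_coset_iff]
  constructor
  · rintro ⟨x, hx, hx'⟩
    exact ⟨coset z x, (h _).2 ⟨x, hx'.symm, rfl⟩, (inc_coset_iff hp.mul_self).2 (.inl hx)⟩
  · rintro ⟨e, he, hy⟩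
    obtain ⟨x, hx, rfl⟩ := (h e).1 he
    rcases (inc_coset_iff hp.mul_self).1 hy with h1 | h1
    · exact ⟨x, h1, hx.symm⟩
    · refine ⟨a * z * x, ?_, ?_⟩
      · exact h1.trans (by rw [mul_assoc, coset_self_mul])
      · rw [coset_self_mul, hx]

lemma exists_isCycle_bdry (hp : IsRotaryPair a z)
    (hne : Subgroup.zpowers a ≠ conjSubgroup (Subgroup.zpowers a) z) (hm : IsOfFinOrder (a * z))
    (f : RightCosets (Subgroup.zpowers (a * z))) :
    ∃ l, (rotaMap a z).IsCycle l ∧ (rotaMap a z).bdry f = seqClass l := by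
  obtain ⟨g, rfl⟩ := f.exists_mk
  obtain ⟨n, h3, hn, -⟩ := exists_period hp hne hm
  refine ⟨edgeSeq a z g, ?_, bdry_coset hm g⟩
  rw [edgeSeq_eq_list]
  exact ⟨_, (isPeriodicCycle hp hne hm h3 hn g).isCycleThrough⟩

lemma hasFaceLength (hp : IsRotaryPair a z)
    (hne : Subgroup.zpowers a ≠ conjSubgroup (Subgroup.zpowers a) z) (hm : IsOfFinOrder (a * z)) :
    HasFaceLength (rotaMap a z) (orderOf (a * z)) := by
  classical
  intro f
  obtain ⟨g, rfl⟩ := f.exists_mk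
  have hmem : edgeSeq a z g ∈ (rotaMap a z).bdry (coset (a * z) g) := by
    rw [bdry_coset hm]
    exact .inl (List.IsRotated.refl _)
  obtain ⟨n, h3, hn, -⟩ := exists_period hp hne hm
  have hnd : (edgeSeq a z g).Nodup := by
    rw [edgeSeq_eq_list]
    exact (isPeriodicCycle hp hne hm h3 hn g).nodup_list
  have : {e | (rotaMap a z).IncEF e (coset (a * z) g)} = ((edgeSeq a z g).toFinset : Set _) := by
    ext e
    rw [Set.mem_ofPred_eq, incEF_iff_mem hp hne hm hmem, List.coe_toFinset, Set.mem_ofPred_eq]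
  rw [this, Set.encard_coe_eq_coe_finsetCard, List.toFinset_card_of_nodup hnd, length_edgeSeq]

lemma isCircular_iff (hp : IsRotaryPair a z)
    (hne : Subgroup.zpowers a ≠ conjSubgroup (Subgroup.zpowers a) z) (hm : IsOfFinOrder (a * z)) :
    IsCircular (rotaMap a z) ↔
      Nat.card ↥(Subgroup.zpowers a ⊓ Subgroup.zpowers (a * z)) = 1 := by
  obtain ⟨n, h3, hn, hnm⟩ := exists_period hp hne hm
  have hiff : Nat.card ↥(Subgroup.zpowers a ⊓ Subgroup.zpowers (a * z)) = 1 ↔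
      n = orderOf (a * z) := by
    rw [← hnm, eq_comm (a := n), Nat.mul_eq_left (by omega)]
  rw [hiff]
  constructor
  · intro h
    have hmem : edgeSeq a z 1 ∈ (rotaMap a z).bdry (coset (a * z) 1) := by
      rw [bdry_coset hm]
      exact .inl (List.IsRotated.refl _)
    have := h _ _ hmem
    rw [edgeSeq_eq_list] at this
    exact (isPeriodicCycle hp hne hm h3 hn 1).isSimpleCycle_iff.1 this
  · intro h f l hl
    obtain ⟨g, rfl⟩ := f.exists_mk
    obtain ⟨α, e, hc, rfl, -⟩ := exists_isPeriodicCycle hp hne hm h3 hn hl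
    exact hc.isSimpleCycle_iff.2 h

/-- The stabilizer of the boundary cycle of the base face: a rotation or reflection of the cycle
that is induced by an element of `G` comes from `⟨az⟩`. -/
lemma image_bdry_eq_iff (hp : IsRotaryPair a z) (ha : 3 ≤ orderOf a)
    (hne : Subgroup.zpowers a ≠ conjSubgroup (Subgroup.zpowers a) z) (hm : IsOfFinOrder (a * z))
    (g : G) :
    List.map (op g • ·) '' (rotaMap a z).bdry (coset (a * z) 1) =
      (rotaMap a z).bdry (coset (a * z) 1) ↔ g ∈ Subgroup.zpowers (a * z) := by
  have hz := hp.mul_self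
  rw [← bdry_smul hm, RightCosets.op_smul_mk, one_mul]
  have hK : ∀ g, coset (a * z) g = coset (a * z) 1 ↔ g ∈ Subgroup.zpowers (a * z) := fun g => by
    rw [coset_eq_iff, inv_one, mul_one]
  constructor
  swap
  · intro h
    exact congrArg _ ((hK g).2 h)
  intro h
  have hmem : edgeSeq a z g ∈ seqClass (edgeSeq a z 1) := by
    rw [← bdry_coset hm, ← h]
    change _ ∈ (rotaMap a z).bdry (coset (a * z) g)
    rw [bdry_coset hm]
    exact .inl (List.IsRotated.refl _)
  obtain ⟨n, h3, hn, -⟩ := exists_period hp hne hm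
  have hm3 := (isPeriodicCycle hp hne hm h3 hn 1).three_le'
  obtain ⟨i, hi⟩ := mem_seqClass_edgeSeq.1 hmem
  rw [mul_one] at hi
  have hget : ∀ {l : List (RightCosets (Subgroup.zpowers z))} (_ : edgeSeq a z g = l) (j : ℕ)
      (_ : j < 2) (h : j < l.length), coset z ((a * z) ^ j * g) = l[j] := by
    rintro _ rfl j _ h
    rw [getElem_edgeSeq]
  rcases hi with hi | hi
  -- a rotation
  · have h0 := hget hi 0 (by norm_num) (by rw [length_edgeSeq]; omega)
    have h1 := hget hi 1 (by norm_num) (by rw [length_edgeSeq]; omega)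
    rw [getElem_edgeSeq, coset_involution_eq_iff hz] at h0 h1
    rw [pow_zero, one_mul, one_mul] at h0
    rw [pow_one] at h1
    rcases h0 with rfl | rfl
    · exact Subgroup.npow_mem_zpowers _ _
    · exfalso
      have e1 : a * z * (z * (a * z) ^ i) = a * (a * z) ^ i := by
        rw [← mul_assoc, mul_assoc a z z, hz, mul_one]
      rw [e1, ← mul_assoc z, mul_left_inj, mul_left_inj] at h1
      rcases h1 with h1 | h1
      · exact hp.ne_one (mul_eq_left.1 h1.symm)
      · refine conj_notMem hp hne ?_
        rw [mul_assoc, ← h1]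
        exact Subgroup.mem_zpowers a
  -- a reflection
  · have h0 := hget hi 0 (by norm_num) (by rw [List.length_reverse, length_edgeSeq]; omega)
    have h1 := hget hi 1 (by norm_num) (by rw [List.length_reverse, length_edgeSeq]; omega)
    have hpow : ∀ j : ℕ, j < orderOf (a * z) → (a * z) ^ (orderOf (a * z) - 1 - j) =
        ((a * z) ^ j)⁻¹ * (a * z)⁻¹ := by
      intro j hj
      rw [← mul_inv_rev, ← pow_succ', eq_inv_iff_mul_eq_one, ← pow_add]
      rw [show orderOf (a * z) - 1 - j + (j + 1) = orderOf (a * z) by omega, pow_orderOf_eq_one]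
    rw [List.getElem_reverse, getElem_edgeSeq, length_edgeSeq, hpow _ (by omega),
      coset_involution_eq_iff hz] at h0 h1
    rw [pow_zero, inv_one, one_mul, one_mul] at h0
    rw [pow_one] at h1
    rcases h0 with rfl | rfl
    · exact mul_mem (inv_mem (Subgroup.mem_zpowers _)) (Subgroup.npow_mem_zpowers _ _)
    · exfalso
      have hinv : (a * z)⁻¹ = z * a⁻¹ := by rw [mul_inv_rev, hp.inv_eq]
      generalize (a * z) ^ i = k at h1
      rw [hinv] at h1
      have ha2 : a * a ∈ Subgroup.zpowers a :=
        mul_mem (Subgroup.mem_zpowers a) (Subgroup.mem_zpowers a)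
      have e1 : a * z * (z * (z * a⁻¹ * k)) = a * (z * a⁻¹ * k) := by
        rw [← mul_assoc, mul_assoc a z z, hz, mul_one]
      have e2 : z * (z * a⁻¹ * (z * a⁻¹) * k) = a⁻¹ * (z * a⁻¹ * k) := by
        simp only [← mul_assoc, hz, one_mul]
      have e3 : z * a⁻¹ * (z * a⁻¹) * k = z * a⁻¹ * (z * a⁻¹ * k) := mul_assoc ..
      rw [e1, e2, e3, mul_left_inj, mul_left_inj] at h1
      rcases h1 with h1 | h1
      · rw [eq_mul_inv_iff_mul_eq] at h1
        exact hp.notMem (h1 ▸ ha2)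
      · rw [eq_inv_iff_mul_eq_one, ← pow_two] at h1
        have := Nat.le_of_dvd (by norm_num) (orderOf_dvd_of_pow_eq_one h1)
        omega

/-! ### The underlying graph -/

lemma coset_ne_coset_mul (hp : IsRotaryPair a z) (g : G) : coset a g ≠ coset a (z * g) := by
  intro h
  rw [eq_comm, coset_eq_iff, mul_inv_cancel_right] at h
  exact hp.notMem h

lemma isGraph (hp : IsRotaryPair a z) : (rotaMap a z).IsGraph := by
  intro e
  obtain ⟨g, rfl⟩ := e.exists_mk
  exact ⟨coset a g, coset a (z * g), coset_ne_coset_mul hp g, fun u => inc_coset_iff hp.mul_self⟩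

lemma adj_coset_mul (hp : IsRotaryPair a z) (g : G) :
    (rotaMap a z).Adj (coset a g) (coset a (z * g)) :=
  ⟨coset_ne_coset_mul hp g, coset z g, (inc_coset_iff hp.mul_self).2 (.inl rfl),
    (inc_coset_iff hp.mul_self).2 (.inr rfl)⟩

lemma adj_coset_iff (hp : IsRotaryPair a z) {g : G} {w : RightCosets (Subgroup.zpowers a)} :
    (rotaMap a z).Adj (coset a g) w ↔
      ∃ h ∈ Subgroup.zpowers a, w = coset a (z * (h * g)) := by
  constructor
  · rintro ⟨hne, e, hv, hw⟩
    obtain ⟨x, hx, rfl⟩ := inc_iff_exists.1 hv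
    refine ⟨x * g⁻¹, coset_eq_iff.1 hx.symm, ?_⟩
    rw [inv_mul_cancel_right]
    exact ((inc_coset_iff hp.mul_self).1 hw).resolve_left fun h => hne (hx.trans h.symm)
  · rintro ⟨h, hh, rfl⟩
    rw [← coset_mul_of_mem hh]
    exact adj_coset_mul hp _

lemma adj_symm {V E : Type*} {Γ : IncGraph V E} {v w : V} (h : Γ.Adj v w) : Γ.Adj w v :=
  ⟨h.1.symm, h.2.imp fun _ h => h.symm⟩

lemma isConnected (hp : IsRotaryPair a z) : (rotaMap a z).IsConnected := by
  refine ⟨⟨coset a 1⟩, fun v w => ?_⟩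
  have key : ∀ g, Relation.ReflTransGen (rotaMap a z).Adj (coset a 1) (coset a g) := by
    intro g
    have : g ∈ Subgroup.closure {a, z} := hp.generates ▸ Subgroup.mem_top g
    induction this using Subgroup.closure_induction_left with
    | one => exact .refl
    | mul_left x hx y _ ih =>
      rcases hx with rfl | rfl
      · rwa [coset_self_mul]
      · exact ih.tail (adj_coset_mul hp y)
    | inv_mul_cancel x hx y _ ih =>
      rcases hx with rfl | rfl
      · rwa [coset_mul_of_mem (inv_mem (Subgroup.mem_zpowers x))]
      · rw [hp.inv_eq]
        exact ih.tail (adj_coset_mul hp y)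
  obtain ⟨g, rfl⟩ := v.exists_mk
  obtain ⟨h, rfl⟩ := w.exists_mk
  have : Std.Symm (rotaMap a z).Adj := ⟨fun _ _ => adj_symm⟩
  exact (symm (key g)).trans (key h)

lemma setOf_inc_coset (g : G) : {e | (rotaMap a z).Inc (coset a g) e} =
    (fun h => coset z (h * g)) '' (Subgroup.zpowers a : Set G) := by
  ext e
  rw [Set.mem_ofPred_eq, inc_iff_exists]
  constructor
  · rintro ⟨x, hx, rfl⟩
    exact ⟨x * g⁻¹, coset_eq_iff.1 hx.symm, by simp⟩
  · rintro ⟨h, hh, rfl⟩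
    exact ⟨h * g, (coset_mul_of_mem hh g).symm, rfl⟩

lemma isLocallyFinite (hp : IsRotaryPair a z) : (rotaMap a z).IsLocallyFinite := by
  intro v
  obtain ⟨g, rfl⟩ := v.exists_mk
  have hfin : Finite (Subgroup.zpowers a) := hp.finite_zpowers
  rw [setOf_inc_coset]
  exact (Set.toFinite _).image _

lemma hasValency (hp : IsRotaryPair a z) : (rotaMap a z).HasValency
    ((Subgroup.zpowers a ⊓ conjSubgroup (Subgroup.zpowers a) z).relIndex (Subgroup.zpowers a)) := by
  intro v
  obtain ⟨g, rfl⟩ := v.exists_mk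
  set H := Subgroup.zpowers a with hH
  have hfin : Finite H := hp.finite_zpowers
  set N := (H ⊓ conjSubgroup H z).subgroupOf H with hN
  -- the neighbours of `⟨a⟩ g` are the `⟨a⟩ z h⁻¹ g` with `h` running over `⟨a⟩` modulo `N`
  have hφ : ∀ h h' : H, coset a (z * ((h⁻¹ : H) * g)) = coset a (z * ((h'⁻¹ : H) * g)) ↔
      QuotientGroup.leftRel N h h' := by
    intro h h'
    rw [QuotientGroup.leftRel_apply, hN, Subgroup.mem_subgroupOf, Subgroup.mem_inf,
      mem_conjSubgroup, and_iff_right (h⁻¹ * h').2, coset_eq_iff]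
    have : z * ((h⁻¹ : H) * g) * (z * ((h'⁻¹ : H) * g))⁻¹ = z * ((h⁻¹ * h' : H) : G) * z⁻¹ := by
      push_cast
      group
    rw [this]
  let φ : H ⧸ N → RightCosets H := Quotient.lift (fun h : H => coset a (z * ((h⁻¹ : H) * g)))
    fun h h' hh => (hφ h h').2 hh
  have hinj : Function.Injective φ := by
    intro x y
    induction x using QuotientGroup.induction_on with | H h => ?_
    induction y using QuotientGroup.induction_on with | H h' => ?_
    exact fun hxy => Quotient.sound ((hφ h h').1 hxy)
  have hrange : {w | (rotaMap a z).Adj (coset a g) w} = Set.range φ := by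
    ext w
    rw [Set.mem_ofPred_eq, adj_coset_iff hp]
    constructor
    · rintro ⟨h, hh, rfl⟩
      refine ⟨((⟨h, hh⟩⁻¹ : H) : H ⧸ N), ?_⟩
      change coset a (z * ((((⟨h, hh⟩⁻¹ : H)⁻¹ : H) : G) * g)) = _
      rw [inv_inv]
    · rintro ⟨x, rfl⟩
      induction x using QuotientGroup.induction_on with | H h => ?_
      exact ⟨_, (h⁻¹).2, rfl⟩
  change {w | (rotaMap a z).Adj (coset a g) w}.encard = _
  rw [hrange, ← Set.image_univ, hinj.encard_image, Set.encard_univ, Subgroup.relIndex,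
    Subgroup.index, ENat.card_eq_coe_natCard]

lemma hasEdgeMultiplicity (hp : IsRotaryPair a z) : (rotaMap a z).HasEdgeMultiplicity
    (Nat.card ↥(Subgroup.zpowers a ⊓ conjSubgroup (Subgroup.zpowers a) z)) := by
  rintro v w ⟨hvw, e, hv, hw⟩
  have hz := hp.mul_self
  obtain ⟨g, rfl, rfl⟩ := inc_iff_exists.1 hv
  obtain rfl := ((inc_coset_iff hz).1 hw).resolve_left hvw.symm
  set N := Subgroup.zpowers a ⊓ conjSubgroup (Subgroup.zpowers a) z
  have hfin : Finite (Subgroup.zpowers a) := hp.finite_zpowers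
  have hfin' : Finite N := Finite.of_injective (Subgroup.inclusion (inf_le_left : N ≤ _))
    (Subgroup.inclusion_injective _)
  have hset : {e | (rotaMap a z).Inc (coset a g) e ∧ (rotaMap a z).Inc (coset a (z * g)) e} =
      (fun c => coset z (c * g)) '' (N : Set G) := by
    ext e
    constructor
    · rintro ⟨h1, h2⟩
      have h0 : e ∈ {e | (rotaMap a z).Inc (coset a g) e} := h1
      rw [setOf_inc_coset] at h0
      obtain ⟨h, hh, rfl⟩ := h0
      refine ⟨h, ⟨hh, ?_⟩, rfl⟩
      rcases (inc_coset_iff hz).1 h2 with h3 | h3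
      · rw [coset_mul_of_mem hh] at h3
        exact absurd h3.symm hvw
      · rw [eq_comm, coset_eq_iff, mul_inv_rev, ← mul_assoc, mul_assoc z,
          mul_inv_cancel_right] at h3
        exact mem_conjSubgroup.2 h3
    · rintro ⟨c, ⟨hc, hc'⟩, rfl⟩
      refine ⟨(inc_coset_iff hz).2 (.inl (coset_mul_of_mem hc g).symm),
        (inc_coset_iff hz).2 (.inr ?_)⟩
      rw [eq_comm, coset_eq_iff, mul_inv_rev, ← mul_assoc, mul_assoc z, mul_inv_cancel_right]
      exact mem_conjSubgroup.1 hc'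
  rw [hset, Set.InjOn.encard_image, Set.encard, ENat.card_eq_coe_natCard]
  · rfl
  · intro c hc c' hc' h
    rw [coset_involution_eq_iff hz, mul_left_inj, ← mul_assoc, mul_left_inj] at h
    refine h.resolve_right fun h => hp.notMem ?_
    rw [eq_mul_inv_of_mul_eq h.symm]
    exact mul_mem hc.1 (inv_mem hc'.1)

/-! ### The action of the group -/

lemma arcTransitive : ArcTransitive Gᵐᵒᵖ (rotaMap a z).toIncGraph := by
  intro v e v' e' h h'
  obtain ⟨g, rfl, rfl⟩ := inc_iff_exists.1 h
  obtain ⟨g', rfl, rfl⟩ := inc_iff_exists.1 h'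
  exact ⟨op (g⁻¹ * g'), by rw [RightCosets.op_smul_mk, mul_inv_cancel_left],
    by rw [RightCosets.op_smul_mk, mul_inv_cancel_left]⟩

lemma actsOnGraph (hp : IsRotaryPair a z) : ActsOnGraph Gᵐᵒᵖ (rotaMap a z).toIncGraph where
  inc_iff g v e := smul_inter_nonempty_iff g v e
  faithful := by
    refine ⟨fun {x y} h => ?_⟩
    have h1 : x • coset a 1 = y • coset a 1 := Sum.inl_injective (h (.inl (coset a 1)))
    have h2 : x • coset z 1 = y • coset z 1 := Sum.inr_injective (h (.inr (coset z 1)))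
    rw [← MulOpposite.op_unop x, ← MulOpposite.op_unop y, RightCosets.op_smul_mk,
      RightCosets.op_smul_mk, one_mul, one_mul] at h1 h2
    rw [coset_involution_eq_iff hp.mul_self] at h2
    refine MulOpposite.unop_injective (h2.resolve_right fun h2 => hp.notMem ?_)
    rwa [coset_eq_iff, h2, mul_inv_cancel_right] at h1

lemma isRotary (hp : IsRotaryPair a z) (hm : IsOfFinOrder (a * z)) :
    IsRotary Gᵐᵒᵖ (rotaMap a z) where
  acts :=
    { onGraph := actsOnGraph hp
      incVF_iff := fun g v f => smul_inter_nonempty_iff g v f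
      incEF_iff := fun g e f => smul_inter_nonempty_iff g e f
      bdry_smul := bdry_smul hm }
  vertexRotary :=
    { acts := actsOnGraph hp
      arcTransitive := arcTransitive
      cyclic := fun v => by
        obtain ⟨g, rfl⟩ := v.exists_mk
        exact inducesCyclic_stabilizer_coset a g _
      transitive := fun v e e' h h' => by
        obtain ⟨x, hx, hx'⟩ := arcTransitive v e v e' h h'
        exact ⟨x, hx, hx'⟩ }
  faceRotary :=
    { arcTransitive := arcTransitive
      cyclic := fun f => by
        obtain ⟨g, rfl⟩ := f.exists_mk
        exact inducesCyclic_stabilizer_coset (a * z) g _ }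

lemma ker_toPermHom_vertices (hp : IsRotaryPair a z) :
    (MulAction.toPermHom Gᵐᵒᵖ (RightCosets (Subgroup.zpowers a))).ker =
      (Subgroup.zpowers a ⊓ conjSubgroup (Subgroup.zpowers a) z).op := by
  ext x
  have hx : x ∈ (MulAction.toPermHom Gᵐᵒᵖ (RightCosets (Subgroup.zpowers a))).ker ↔
      ∀ g, g * x.unop * g⁻¹ ∈ Subgroup.zpowers a := by
    rw [MonoidHom.mem_ker, Equiv.ext_iff]
    constructor
    · exact fun h g => mem_stabilizer_coset.1 (h (coset a g))
    · intro h T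
      obtain ⟨g, rfl⟩ := T.exists_mk
      exact mem_stabilizer_coset.2 (h g)
  rw [hx, Subgroup.mem_op]
  constructor
  · intro h
    exact ⟨by simpa using h 1, mem_conjSubgroup.2 (h z)⟩
  · exact fun h g => (conj_mem_inf hp h g).1

lemma ker_toPermHom_vertices_faces (hp : IsRotaryPair a z) :
    (MulAction.toPermHom Gᵐᵒᵖ
      (RightCosets (Subgroup.zpowers a) ⊕ RightCosets (Subgroup.zpowers (a * z)))).ker =
      (Subgroup.zpowers a ⊓ Subgroup.zpowers (a * z)).op := by
  ext x
  rw [MonoidHom.mem_ker, Equiv.ext_iff, Subgroup.mem_op]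
  constructor
  · intro h
    have h1 := mem_stabilizer_coset.1 (Sum.inl_injective (h (.inl (coset a 1))))
    have h2 := mem_stabilizer_coset.1 (Sum.inr_injective (h (.inr (coset (a * z) 1))))
    simp only [one_mul, inv_one, mul_one] at h1 h2
    exact ⟨h1, h2⟩
  · intro h T
    have hc : ∀ g, g * x.unop * g⁻¹ = x.unop := fun g => by
      rw [(commute_of_mem hp h g).eq, mul_inv_cancel_right]
    rcases T with T | T <;> obtain ⟨g, rfl⟩ := T.exists_mk
    · refine congrArg Sum.inl (mem_stabilizer_coset.2 ?_)
      rw [hc]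
      exact h.1
    · refine congrArg Sum.inr (mem_stabilizer_coset.2 ?_)
      rw [hc]
      exact h.2

lemma faithfulSMul_iff_ker_eq_bot {A X : Type*} [Group A] [MulAction A X] :
    FaithfulSMul A X ↔ (MulAction.toPermHom A X).ker = ⊥ := by
  rw [MonoidHom.ker_eq_bot_iff]
  constructor
  · intro h
    exact MulAction.toPerm_injective
  · intro h
    exact ⟨fun {x y} hxy => h (Equiv.ext hxy)⟩

lemma faithfulSMul_iff (hp : IsRotaryPair a z) :
    FaithfulSMul Gᵐᵒᵖ
      (RightCosets (Subgroup.zpowers a) ⊕ RightCosets (Subgroup.zpowers (a * z))) ↔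
      Nat.card ↥(Subgroup.zpowers a ⊓ Subgroup.zpowers (a * z)) = 1 := by
  rw [faithfulSMul_iff_ker_eq_bot, ker_toPermHom_vertices_faces hp, Subgroup.op_eq_bot,
    Subgroup.card_eq_one]

end

open unitInterval Topology

/-! ### Rotations of the plane and polar coordinates on a triangle -/

/-- The point of the unit circle reached after `t` of `n` equal steps. -/
noncomputable def turn (n : ℕ) (t : ℂ) : ℂ :=
  Complex.exp (2 * Real.pi * Complex.I * (t / n))

lemma turn_zero (n : ℕ) : turn n 0 = 1 := by simp [turn]

lemma turn_add (n : ℕ) (s t : ℂ) : turn n (s + t) = turn n s * turn n t := by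
  rw [turn, turn, turn, ← Complex.exp_add]
  congr 1
  ring

lemma norm_turn (n : ℕ) (t : ℝ) : ‖turn n t‖ = 1 := by
  have h : 2 * Real.pi * Complex.I * ((t : ℂ) / n) =
      ((2 * Real.pi * (t / n) : ℝ) : ℂ) * Complex.I := by
    push_cast
    ring
  rw [turn, h, Complex.norm_exp_ofReal_mul_I]

lemma turn_eq_iff {n : ℕ} (hn : n ≠ 0) (s t : ℝ) :
    turn n s = turn n t ↔ ∃ k : ℤ, s = t + n * k := by
  have hn' : (n : ℂ) ≠ 0 := Nat.cast_ne_zero.2 hn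
  rw [turn, turn, Complex.exp_eq_exp_iff_exists_int]
  refine exists_congr fun k => ?_
  have h : (2 * Real.pi * Complex.I * ((s : ℂ) / n) =
      2 * Real.pi * Complex.I * ((t : ℂ) / n) + k * (2 * Real.pi * Complex.I)) ↔
      (2 * Real.pi * Complex.I) * ((s : ℂ) / n) =
        (2 * Real.pi * Complex.I) * ((t : ℂ) / n + k) := by
    rw [mul_add, mul_comm (k : ℂ)]
  rw [h, mul_right_inj' Complex.two_pi_I_ne_zero, div_add' _ _ _ hn', div_left_inj' hn']
  constructor
  · intro h
    have : ((s : ℝ) : ℂ) = ((t + n * k : ℝ) : ℂ) := by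
      push_cast
      rw [h]
      ring
    exact_mod_cast this
  · rintro rfl
    push_cast
    ring

lemma turn_intCast_eq_iff {n : ℕ} (hn : n ≠ 0) (i j : ℤ) :
    turn n i = turn n j ↔ (n : ℤ) ∣ i - j := by
  have := turn_eq_iff hn (i : ℝ) (j : ℝ)
  push_cast at this
  rw [this]
  refine exists_congr fun k => ?_
  rw [sub_eq_iff_eq_add']
  exact_mod_cast Iff.rfl

lemma continuous_turn (n : ℕ) : Continuous (turn n) := by
  unfold turn
  fun_prop

/-- The point of the triangle `x + y ≤ 1` with `x + y = r` and `y = r * t`. -/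
noncomputable def triPoint (r t : I) : I × I := (r * σ t, r * t)

lemma continuous_triPoint : Continuous fun p : I × I => triPoint p.1 p.2 := by
  unfold triPoint
  fun_prop

lemma exists_triPoint {x y : I} (h : (x + y : ℝ) ≤ 1) : ∃ r t, (x, y) = triPoint r t := by
  have hx := x.2.1
  have hy := y.2.1
  rcases (add_nonneg hx hy).eq_or_lt' with h0 | h0
  · have hx0 : x = 0 := Subtype.ext (by simp only [Set.Icc.coe_zero]; linarith)
    have hy0 : y = 0 := Subtype.ext (by simp only [Set.Icc.coe_zero]; linarith)
    exact ⟨0, 0, by simp [triPoint, hx0, hy0]⟩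
  · refine ⟨⟨x + y, h0.le, h⟩, ⟨y / (x + y), by positivity, div_le_one_of_le₀ (by linarith) h0.le⟩,
      ?_⟩
    refine Prod.ext (Subtype.ext ?_) (Subtype.ext ?_) <;>
      simp only [triPoint, Set.Icc.coe_mul, coe_symm_eq] <;> field_simp
    ring

/-- The conical map of the square that sends the point of the triangle with `x + y = r` and
`y = r * t` to `r * turn n t`. -/
noncomputable def sectorMap (n : ℕ) (p : I × I) : ℂ :=
  ((p.1 + p.2 : ℝ) : ℂ) * turn n ((p.2 / (p.1 + p.2) : ℝ) : ℂ)

lemma continuous_sectorMap (n : ℕ) : Continuous (sectorMap n) := by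
  rw [continuous_iff_continuousAt]
  intro p
  have hx := p.1.2.1
  have hy := p.2.2.1
  rcases (add_nonneg hx hy).eq_or_lt' with h0 | h0
  -- at the apex the angle is undefined, but the modulus tends to `0`
  · have hv : sectorMap n p = 0 := by
      rw [sectorMap, h0]
      simp
    rw [ContinuousAt, hv]
    refine squeeze_zero_norm (a := fun q : I × I => (q.1 + q.2 : ℝ)) (fun q => ?_) ?_
    · rw [sectorMap, norm_mul, norm_turn, mul_one, Complex.norm_real, Real.norm_eq_abs,
        abs_of_nonneg (add_nonneg q.1.2.1 q.2.2.1)]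
    · rw [← h0]
      exact Continuous.tendsto (by fun_prop) p
  · unfold sectorMap
    refine ContinuousAt.mul (by fun_prop) ((continuous_turn n).continuousAt.comp' ?_)
    refine Complex.continuous_ofReal.continuousAt.comp' ?_
    exact ContinuousAt.div (by fun_prop) (by fun_prop) h0.ne'

lemma sectorMap_triPoint (n : ℕ) (r t : I) :
    sectorMap n (triPoint r t) = (r : ℝ) * turn n (t : ℝ) := by
  have h : (((r * σ t : I) : ℝ) + ((r * t : I) : ℝ)) = r := by
    simp only [Set.Icc.coe_mul, coe_symm_eq]
    ring
  rw [sectorMap, triPoint]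
  simp only [h]
  rcases eq_or_ne (r : ℝ) 0 with h0 | h0
  · simp [h0]
  · simp [h0]

/-- The tent function of the corner `(0, 0)` of the square. -/
noncomputable def tent (p : I × I) : ℂ := (max 0 (1 - p.1 - p.2 : ℝ) : ℝ)

lemma continuous_tent : Continuous tent := by
  unfold tent
  fun_prop

lemma tent_eq_zero_iff (p : I × I) : tent p = 0 ↔ 1 ≤ (p.1 + p.2 : ℝ) := by
  rw [tent, Complex.ofReal_eq_zero, max_eq_left_iff]
  constructor <;> intro h <;> linarith

lemma tent_triPoint (r t : I) : tent (triPoint r t) = 1 - (r : ℝ) := by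
  have h : (1 - ((r * σ t : I) : ℝ) - ((r * t : I) : ℝ)) = 1 - r := by
    simp only [Set.Icc.coe_mul, coe_symm_eq]
    ring
  rw [tent, triPoint]
  simp only [h]
  rw [max_eq_right (by linarith [r.2.2])]
  push_cast
  rfl

/-! ### The surface -/

section

variable {G : Type u} [Group G]

/-- The gluing of the squares `{g} × [0, 1]²`, one for each `g` in `G`. The square of `g` has the
vertex `⟨a⟩ g` at `(0, 0)`, the vertex `⟨a⟩ z g` at `(1, 1)`, and the centres of the faces
`⟨az⟩ g` and `⟨az⟩ z g` at `(1, 0)` and `(0, 1)`. Its left side is glued to the bottom side of the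
square of `a g`, and the squares of `g` and `z g` are the same square, rotated by a half-turn. -/
inductive GlueRel (a z : G) : (Σ _ : G, I × I) → (Σ _ : G, I × I) → Prop
  | rot (g : G) (s : I) : GlueRel a z ⟨g, (0, s)⟩ ⟨a * g, (s, 0)⟩
  | flip (g : G) (x y : I) : GlueRel a z ⟨g, (x, y)⟩ ⟨z * g, (σ x, σ y)⟩

/-- The surface obtained from the squares `{g} × [0, 1]²` by the gluing `GlueRel`. -/
def Surf (a z : G) : Type u := Quot (GlueRel a z)

namespace Surf

instance (a z : G) : TopologicalSpace (Surf a z) :=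
  inferInstanceAs (TopologicalSpace (Quot (GlueRel a z)))

variable {a z : G}

/-- The point with coordinates `p` in the square of `g`. -/
def mk (a z : G) (g : G) (p : I × I) : Surf a z := Quot.mk _ ⟨g, p⟩

lemma continuous_mk (g : G) : Continuous (mk a z g) :=
  continuous_quot_mk.comp continuous_sigmaMk

lemma mk_rot (g : G) (s : I) : mk a z g (0, s) = mk a z (a * g) (s, 0) :=
  Quot.sound (GlueRel.rot g s)

lemma mk_flip (g : G) (x y : I) : mk a z g (x, y) = mk a z (z * g) (σ x, σ y) :=
  Quot.sound (GlueRel.flip g x y)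

lemma exists_mk (P : Surf a z) : ∃ g x y, P = mk a z g (x, y) := by
  induction P using Quot.ind with
  | mk p => exact ⟨p.1, p.2.1, p.2.2, rfl⟩

/-- The conditions under which the function `p` on the square, weighted by `τ g` on the square of
`g`, defines a continuous function on the surface. -/
structure IsHat (a : G) (τ : G → ℂ) (p : I × I → ℂ) : Prop where
  cont : Continuous p
  glue : ∀ g s, τ g * p (0, s) = τ (a * g) * p (s, 0)
  right : ∀ s, p (1, s) = 0
  top : ∀ s, p (s, 1) = 0

/-- The function on the surface that is `τ g * p` on the square of `g`, symmetrized under the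
half-turn that identifies the squares of `g` and `z g`. -/
noncomputable def hat (hz : z * z = 1) {τ : G → ℂ} {p : I × I → ℂ} (h : IsHat a τ p) :
    Surf a z → ℂ :=
  Quot.lift (fun q => τ q.1 * p q.2 + τ (z * q.1) * p (σ q.2.1, σ q.2.2)) (by
    rintro _ _ (⟨g, s⟩ | ⟨g, x, y⟩)
    · simp [h.glue, h.right, h.top]
    · simp [← mul_assoc, hz, add_comm])

lemma hat_mk (hz : z * z = 1) {τ : G → ℂ} {p : I × I → ℂ} (h : IsHat a τ p) (g : G) (x y : I) :
    hat hz h (mk a z g (x, y)) = τ g * p (x, y) + τ (z * g) * p (σ x, σ y) := rfl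

lemma continuous_hat (hz : z * z = 1) {τ : G → ℂ} {p : I × I → ℂ} (h : IsHat a τ p) :
    Continuous (hat hz h) := by
  refine continuous_quot_lift _ (continuous_sigma fun g => ?_)
  have hp := h.cont
  have hs : Continuous fun q : I × I => (σ q.1, σ q.2) := by fun_prop
  change Continuous fun q : I × I => τ g * p q + τ (z * g) * p (σ q.1, σ q.2)
  exact Continuous.add (continuous_const.mul hp) (Continuous.mul continuous_const (hp.comp hs))

/-! ### Discs around vertices -/

open Classical in
/-- The angle of the square of `h = a ^ j` at the vertex `⟨a⟩`, as a point of the unit circle, and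
`0` if `h` is not in `⟨a⟩`. -/
noncomputable def angle (a h : G) : ℂ :=
  if H : ∃ j : ℤ, h = a ^ j then turn (orderOf a) (H.choose : ℤ) else 0

lemma angle_zpow (ha : IsOfFinOrder a) (j : ℤ) : angle a (a ^ j) = turn (orderOf a) j := by
  have H : ∃ i : ℤ, a ^ j = a ^ i := ⟨j, rfl⟩
  rw [angle, dif_pos H, turn_intCast_eq_iff ha.orderOf_pos.ne']
  have h := H.choose_spec
  rw [eq_comm, ← mul_inv_eq_one, ← zpow_neg, ← zpow_add, ← orderOf_dvd_iff_zpow_eq_one] at h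
  exact h

lemma angle_mul (ha : IsOfFinOrder a) (h : G) : angle a (a * h) = turn
    (orderOf a) 1 * angle a h := by
  by_cases H : ∃ j : ℤ, h = a ^ j
  · obtain ⟨j, rfl⟩ := H
    rw [← zpow_one_add, angle_zpow ha, angle_zpow ha, ← turn_add]
    push_cast
    rfl
  · have H' : ¬ ∃ j : ℤ, a * h = a ^ j := by
      rintro ⟨j, hj⟩
      exact H ⟨-1 + j, by rw [zpow_add, ← hj]; simp⟩
    rw [angle, angle, dif_neg H, dif_neg H', mul_zero]

open Classical in
/-- The indicator function of the subgroup `⟨a⟩`. -/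
noncomputable def ind (a h : G) : ℂ := if h ∈ Subgroup.zpowers a then 1 else 0

lemma ind_of_mem {h : G} (H : h ∈ Subgroup.zpowers a) : ind a h = 1 := if_pos H

lemma ind_of_notMem {h : G} (H : h ∉ Subgroup.zpowers a) : ind a h = 0 := if_neg H

lemma ind_mul (h : G) : ind a (a * h) = ind a h := by
  simp only [ind, Subgroup.mul_mem_cancel_left _ (Subgroup.mem_zpowers a)]

lemma isHat_tent (a g₀ : G) : IsHat a (fun g => ind a (g * g₀⁻¹)) tent where
  cont := continuous_tent
  glue g s := by
    rw [mul_assoc, ind_mul]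
    simp [tent]
  right s := by
    rw [tent_eq_zero_iff]
    simpa using s.2.1
  top s := by
    rw [tent_eq_zero_iff]
    simpa using s.2.1

lemma isHat_sector (ha : IsOfFinOrder a) (g₀ : G) :
    IsHat a (fun g => angle a (g * g₀⁻¹)) fun p => tent p * sectorMap (orderOf a) p where
  cont := continuous_tent.mul (continuous_sectorMap _)
  glue g s := by
    rw [mul_assoc, angle_mul ha]
    have h1 : ((0 : I), s) = triPoint s 1 := by simp [triPoint]
    have h2 : (s, (0 : I)) = triPoint s 0 := by simp [triPoint]
    rw [h1, h2, sectorMap_triPoint, sectorMap_triPoint, tent_triPoint, tent_triPoint]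
    simp only [Set.Icc.coe_one, Set.Icc.coe_zero, Complex.ofReal_one, Complex.ofReal_zero,
      turn_zero]
    ring
  right s := by simp [(isHat_tent a g₀).right s]
  top s := by simp [(isHat_tent a g₀).top s]

/-- The height above the boundary of the disc around the vertex `⟨a⟩ g₀`: it is nonzero exactly on
the interior of the disc. -/
noncomputable def height (a : G) (hz : z * z = 1) (g₀ : G) : Surf a z → ℂ :=
  hat hz (isHat_tent a g₀)

/-- The planar coordinate on the disc around the vertex `⟨a⟩ g₀`, scaled by the height. -/
noncomputable def coord (ha : IsOfFinOrder a) (hz : z * z = 1) (g₀ : G) : Surf a z → ℂ :=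
  hat hz (isHat_sector ha g₀)

lemma continuous_height (hz : z * z = 1) (g₀ : G) : Continuous
    (height a hz g₀) := continuous_hat hz _

lemma continuous_coord (hz : z * z = 1) (ha : IsOfFinOrder a) (g₀ : G) : Continuous
    (coord ha hz g₀) :=
  continuous_hat hz _

lemma tent_symm {x y : I} (h : (x + y : ℝ) ≤ 1) : tent (σ x, σ y) = 0 := by
  rw [tent_eq_zero_iff]
  simp only [coe_symm_eq]
  linarith

lemma height_mk_of_le (hz : z * z = 1) (g₀ g : G) {x y : I} (h : (x + y : ℝ) ≤ 1) :
    height a hz g₀ (mk a z g (x, y)) = ind a (g * g₀⁻¹) * tent (x, y) := by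
  rw [height, hat_mk, tent_symm h, mul_zero, add_zero]

lemma coord_mk_of_le (hz : z * z = 1) (ha : IsOfFinOrder a) (g₀ g : G) {x y : I}
    (h : (x + y : ℝ) ≤ 1) :
    coord ha hz g₀ (mk a z g (x, y)) =
      angle a (g * g₀⁻¹) * (tent (x, y) * sectorMap (orderOf a) (x, y)) := by
  rw [coord, hat_mk, tent_symm h, zero_mul, mul_zero, add_zero]

lemma triPoint_add_le (r t : I) : ((triPoint r t).1 + (triPoint r t).2 : ℝ) ≤ 1 := by
  have : ((triPoint r t).1 + (triPoint r t).2 : ℝ) = r := by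
    simp only [triPoint, Set.Icc.coe_mul, coe_symm_eq]
    ring
  rw [this]
  exact r.2.2

lemma exists_of_height_ne_zero (hz : z * z = 1) {g₀ : G} {P : Surf a z} (h : height a hz g₀ P ≠ 0) :
    ∃ g x y, P = mk a z g (x, y) ∧ g * g₀⁻¹ ∈ Subgroup.zpowers a ∧ (x + y : ℝ) < 1 := by
  obtain ⟨g, x, y, rfl⟩ := exists_mk P
  have key : ∀ g (x y : I), ind a (g * g₀⁻¹) * tent (x, y) ≠ 0 →
      g * g₀⁻¹ ∈ Subgroup.zpowers a ∧ (x + y : ℝ) < 1 := fun g x y h => by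
    constructor
    · by_contra hg
      exact h (by rw [ind_of_notMem hg, zero_mul])
    · by_contra hxy
      exact h (by rw [(tent_eq_zero_iff (x, y)).2 (not_lt.1 hxy), mul_zero])
  rw [height, hat_mk] at h
  by_cases h1 : ind a (g * g₀⁻¹) * tent (x, y) = 0
  · rw [h1, zero_add] at h
    exact ⟨z * g, σ x, σ y, mk_flip .., key _ _ _ h⟩
  · exact ⟨g, x, y, rfl, key _ _ _ h1⟩

open Classical in
/-- The closed disc around the vertex `⟨a⟩ g₀`, parametrized by the closed unit disc: the `j`-th
sector goes to the triangle `x + y ≤ 1` in the square of `a ^ j * g₀`. -/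
noncomputable def disc (a z g₀ : G) (w : ℂ) : Surf a z :=
  if H : ∃ (j : ℤ) (r t : I), w = (r : ℝ) * turn (orderOf a) (j + (t : ℝ)) then
    mk a z (a ^ H.choose * g₀) (triPoint H.choose_spec.choose H.choose_spec.choose_spec.choose)
  else mk a z g₀ (0, 0)

lemma mk_zpow_zero (j : ℤ) (g₀ : G) : mk a z (a ^ j * g₀) (0, 0) = mk a z g₀ (0, 0) := by
  induction j with
  | zero => simp
  | succ i ih => rw [add_comm, zpow_add, zpow_one, mul_assoc, ← mk_rot, ih]
  | pred i ih =>
    rw [mk_rot, ← mul_assoc, ← zpow_one_add]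
    simpa using ih

lemma mk_eq_of_polar_eq (ha : IsOfFinOrder a) (g₀ : G) {j j' : ℤ} {r r' t t' : I}
    (h : (r : ℝ) * turn (orderOf a) (j + (t : ℝ)) = (r' : ℝ) * turn (orderOf a) (j' + (t' : ℝ))) :
    mk a z (a ^ j * g₀) (triPoint r t) = mk a z (a ^ j' * g₀) (triPoint r' t') := by
  have key : ∀ (j : ℤ) (t : I), turn (orderOf a) (j + (t : ℝ)) =
      turn (orderOf a) (((j + t : ℝ) : ℝ) : ℂ) := by
    intro j t
    push_cast
    rfl
  rw [key, key] at h
  have hr : r = r' := by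
    have := congrArg norm h
    rw [norm_mul, norm_mul, norm_turn, norm_turn, Complex.norm_real, Complex.norm_real,
      mul_one, mul_one, Real.norm_of_nonneg r.2.1, Real.norm_of_nonneg r'.2.1] at this
    exact Subtype.ext this
  subst hr
  rcases eq_or_ne r 0 with rfl | hr
  · simp only [triPoint, zero_mul]
    rw [mk_zpow_zero, mk_zpow_zero]
  have hr' : ((r : ℝ) : ℂ) ≠ 0 := by
    exact_mod_cast fun h0 => hr (Subtype.ext h0)
  rw [mul_right_inj' hr', turn_eq_iff ha.orderOf_pos.ne'] at h
  obtain ⟨k, hk⟩ := h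
  -- after a change of `j'` by a multiple of the order of `a`, the two angles agree
  have hj : a ^ j' = a ^ (j' + orderOf a * k) := by
    rw [zpow_add, zpow_mul, zpow_natCast, pow_orderOf_eq_one, one_zpow, mul_one]
  rw [hj]
  generalize hi : j' + orderOf a * k = i
  have hi' : (j : ℝ) + t = i + t' := by
    rw [hk, ← hi]
    push_cast
    ring
  have ht0 := t.2.1
  have ht1 := t.2.2
  have ht0' := t'.2.1
  have ht1' := t'.2.2
  have h1 : j ≤ i + 1 := by
    have : (j : ℝ) ≤ i + 1 := by linarith
    exact_mod_cast this
  have h2 : i ≤ j + 1 := by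
    have : (i : ℝ) ≤ j + 1 := by linarith
    exact_mod_cast this
  have step : ∀ (i : ℤ), mk a z (a ^ i * g₀) (triPoint r 1) =
      mk a z (a ^ (i + 1) * g₀) (triPoint r 0) := by
    intro i
    simp only [triPoint, symm_one, symm_zero, mul_zero, mul_one]
    rw [mk_rot, add_comm, zpow_add, zpow_one, mul_assoc]
  obtain rfl | rfl | rfl : j = i ∨ j = i + 1 ∨ i = j + 1 := by omega
  · rw [Subtype.ext (show (t : ℝ) = t' by linarith)]
  · push_cast at hi'
    rw [Subtype.ext (show (t : ℝ) = (0 : I) by simp only [Set.Icc.coe_zero]; linarith),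
      Subtype.ext (show (t' : ℝ) = (1 : I) by simp only [Set.Icc.coe_one]; linarith), step]
  · push_cast at hi'
    rw [Subtype.ext (show (t' : ℝ) = (0 : I) by simp only [Set.Icc.coe_zero]; linarith),
      Subtype.ext (show (t : ℝ) = (1 : I) by simp only [Set.Icc.coe_one]; linarith), step]

lemma disc_polar (ha : IsOfFinOrder a) (g₀ : G) (j : ℤ) (r t : I) :
    disc a z g₀ ((r : ℝ) * turn (orderOf a) (j + (t : ℝ))) =
      mk a z (a ^ j * g₀) (triPoint r t) := by
  have H : ∃ (j' : ℤ) (r' t' : I), ((r : ℝ) : ℂ) * turn (orderOf a) (j + (t : ℝ)) =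
      (r' : ℝ) * turn (orderOf a) (j' + (t' : ℝ)) := ⟨j, r, t, rfl⟩
  rw [disc, dif_pos H]
  exact mk_eq_of_polar_eq ha g₀ H.choose_spec.choose_spec.choose_spec.symm

lemma norm_polar (n : ℕ) (j : ℤ) (r t : I) : ‖((r : ℝ) : ℂ) * turn n (j + (t : ℝ))‖ = r := by
  have := norm_turn n (j + t)
  push_cast at this
  rw [norm_mul, this, mul_one, Complex.norm_real, Real.norm_of_nonneg r.2.1]

lemma exists_polar {n : ℕ} (hn : n ≠ 0) {w : ℂ} (hw : ‖w‖ ≤ 1) :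
    ∃ (j : Fin n) (r t : I), w = (r : ℝ) * turn n (((j : ℕ) : ℤ) + (t : ℝ)) := by
  have hn' : (0 : ℝ) < n := by positivity
  have hpi := Real.pi_pos
  -- the argument of `w`, in units of `2π / n`, taken modulo `n`
  set s : ℝ := Complex.arg w / (2 * Real.pi) with hs
  set u : ℝ := n * Int.fract s with hu
  have hu0 : 0 ≤ u := mul_nonneg hn'.le (Int.fract_nonneg _)
  have hun : u < n := by
    have := Int.fract_lt_one s
    nlinarith
  have hfl : ⌊u⌋₊ < n := (Nat.floor_lt hu0).2 hun
  refine ⟨⟨⌊u⌋₊, hfl⟩, ⟨‖w‖, norm_nonneg _, hw⟩,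
    ⟨u - ⌊u⌋₊, sub_nonneg.2 (Nat.floor_le hu0), by linarith [(Nat.lt_floor_add_one u).le]⟩, ?_⟩
  have h1 : ((((⌊u⌋₊ : ℕ) : ℤ) : ℂ) + ((u - ⌊u⌋₊ : ℝ) : ℂ)) = ((u : ℝ) : ℂ) := by
    push_cast
    ring
  have h2 : turn n (u : ℝ) = turn n ((n * s : ℝ) : ℝ) := by
    rw [turn_eq_iff hn]
    refine ⟨-⌊s⌋, ?_⟩
    rw [hu, Int.fract]
    push_cast
    ring
  have h3 : turn n ((n * s : ℝ) : ℝ) = Complex.exp (Complex.arg w * Complex.I) := by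
    rw [turn]
    congr 1
    have : (n : ℂ) ≠ 0 := Nat.cast_ne_zero.2 hn
    have : (Real.pi : ℂ) ≠ 0 := Complex.ofReal_ne_zero.2 hpi.ne'
    rw [hs]
    push_cast
    field_simp
  simp only
  rw [h1, h2, h3, Complex.norm_mul_exp_arg_mul_I]

lemma continuousOn_disc (ha : IsOfFinOrder a) (g₀ : G) :
    ContinuousOn (disc a z g₀) (Metric.closedBall 0 1) := by
  -- polar coordinates present the closed disc as a quotient of a compact space
  have hn := ha.orderOf_pos.ne'
  let π : (Σ _ : Fin (orderOf a), I × I) → Metric.closedBall (0 : ℂ) 1 := fun q =>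
    ⟨(q.2.1 : ℝ) * turn (orderOf a) (((q.1 : ℕ) : ℤ) + (q.2.2 : ℝ)), by
      rw [mem_closedBall_zero_iff, norm_polar]
      exact q.2.1.2.2⟩
  have hπ : Continuous π := by
    refine Continuous.subtype_mk (continuous_sigma fun j => ?_) _
    refine Continuous.mul (by fun_prop) ((continuous_turn _).comp (by fun_prop))
  have hsurj : Function.Surjective π := by
    rintro ⟨w, hw⟩
    obtain ⟨j, r, t, h⟩ := exists_polar hn (mem_closedBall_zero_iff.1 hw)
    exact ⟨⟨j, r, t⟩, Subtype.ext h.symm⟩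
  have hq := hπ.isClosedMap.isQuotientMap hπ hsurj
  rw [continuousOn_iff_continuous_domRestrict, hq.continuous_iff]
  refine continuous_sigma fun j => ?_
  have : ((Metric.closedBall (0 : ℂ) 1).domRestrict (disc a z g₀) ∘ π) ∘ Sigma.mk j =
      fun p : I × I => mk a z (a ^ ((j : ℕ) : ℤ) * g₀) (triPoint p.1 p.2) := by
    funext p
    exact disc_polar ha g₀ _ _ _
  change Continuous (((Metric.closedBall (0 : ℂ) 1).domRestrict (disc a z g₀) ∘ π) ∘ Sigma.mk j)
  rw [this]
  exact (continuous_mk _).comp continuous_triPoint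

lemma height_disc (hz : z * z = 1) (ha : IsOfFinOrder a) (g₀ : G) {w : ℂ} (hw : ‖w‖ ≤ 1) :
    height a hz g₀ (disc a z g₀ w) = 1 - ‖w‖ := by
  obtain ⟨j, r, t, rfl⟩ := exists_polar ha.orderOf_pos.ne' hw
  rw [disc_polar ha, ← Prod.mk.eta (p := triPoint r t),
    height_mk_of_le hz _ _ (triPoint_add_le r t),
    norm_polar, mul_inv_cancel_right, ind_of_mem (Subgroup.zpow_mem_zpowers a _), one_mul,
    Prod.mk.eta, tent_triPoint]

lemma coord_disc (hz : z * z = 1) (ha : IsOfFinOrder a) (g₀ : G) {w : ℂ} (hw : ‖w‖ ≤ 1) :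
    coord ha hz g₀ (disc a z g₀ w) = (1 - ‖w‖) * w := by
  obtain ⟨j, r, t, rfl⟩ := exists_polar ha.orderOf_pos.ne' hw
  rw [disc_polar ha, ← Prod.mk.eta (p := triPoint r t),
    coord_mk_of_le hz ha _ _ (triPoint_add_le r t),
    norm_polar, mul_inv_cancel_right, angle_zpow ha,
    Prod.mk.eta, tent_triPoint, sectorMap_triPoint, turn_add]
  ring

lemma exists_disc_eq (ha : IsOfFinOrder a) {g g₀ : G} (hg : g * g₀⁻¹ ∈ Subgroup.zpowers a) {x y : I}
    (h : (x + y : ℝ) ≤ 1) : ∃ w : ℂ, ‖w‖ = x + y ∧ disc a z g₀ w = mk a z g (x, y) := by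
  obtain ⟨j, hj⟩ := hg
  obtain ⟨r, t, hrt⟩ := exists_triPoint h
  refine ⟨(r : ℝ) * turn (orderOf a) (j + (t : ℝ)), ?_, ?_⟩
  · obtain ⟨rfl, rfl⟩ := Prod.ext_iff.1 hrt
    rw [norm_polar]
    simp only [triPoint, Set.Icc.coe_mul, coe_symm_eq]
    ring
  · rw [disc_polar ha, hrt]
    congr 1
    simpa [eq_mul_inv_iff_mul_eq] using hj

lemma exists_disc_of_height_ne_zero (hz : z * z = 1) (ha : IsOfFinOrder a) {g₀ : G} {P : Surf a z}
    (h : height a hz g₀ P ≠ 0) : ∃ w : ℂ, ‖w‖ < 1 ∧ disc a z g₀ w = P := by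
  obtain ⟨g, x, y, rfl, hg, hxy⟩ := exists_of_height_ne_zero hz h
  obtain ⟨w, hw, h⟩ := exists_disc_eq (z := z) ha hg hxy.le
  exact ⟨w, hw ▸ hxy, h⟩

lemma eq_of_height_eq_of_coord_eq (hz : z * z = 1) (ha : IsOfFinOrder a) {g₀ : G} {P Q : Surf a z}
    (h0 : height a hz g₀ P ≠ 0) (h : height a hz g₀ P = height a hz g₀ Q)
    (h' : coord ha hz g₀ P = coord ha hz g₀ Q) : P = Q := by
  obtain ⟨w, hw, rfl⟩ := exists_disc_of_height_ne_zero hz ha h0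
  obtain ⟨w', hw', rfl⟩ := exists_disc_of_height_ne_zero hz ha (h ▸ h0)
  rw [height_disc hz ha _ hw.le, height_disc hz ha _ hw'.le] at h
  rw [coord_disc hz ha _ hw.le, coord_disc hz ha _ hw'.le, ← h] at h'
  rw [height_disc hz ha _ hw.le] at h0
  rw [mul_left_cancel₀ h0 h']

lemma disc_injOn (hz : z * z = 1) (ha : IsOfFinOrder a) (g₀ : G) : Set.InjOn (disc a z g₀)
    (Metric.ball 0 1) := by
  intro w hw w' hw' h
  rw [mem_ball_zero_iff] at hw hw'
  have h1 := height_disc hz ha g₀ hw.le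
  have h2 := coord_disc hz ha g₀ hw.le
  rw [h, height_disc hz ha g₀ hw'.le] at h1
  rw [h, coord_disc hz ha g₀ hw'.le, h1] at h2
  have h0 : (1 - ‖w‖ : ℂ) ≠ 0 := by
    rw [sub_ne_zero]
    exact_mod_cast hw.ne'
  exact (mul_left_cancel₀ h0 h2).symm

/-! ### Functions supported on one square -/

/-- A function on the square that vanishes exactly on the boundary. -/
noncomputable def bump (p : I × I) : ℂ := ((p.1 * σ p.1 * (p.2 * σ p.2) : I) : ℝ)

lemma bump_ne_zero_iff (p : I × I) : bump p ≠ 0 ↔ p.1 ≠ 0 ∧ p.1 ≠ 1 ∧ p.2 ≠ 0 ∧ p.2 ≠ 1 := by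
  have h : ∀ x : I, σ x = 0 ↔ x = 1 := fun x => by rw [← symm_one, symm_bijective.1.eq_iff]
  rw [bump, Ne, Complex.ofReal_eq_zero, Set.Icc.coe_eq_zero, mul_eq_zero, mul_eq_zero, mul_eq_zero,
    h, h]
  tauto

open Classical in
lemma isHat_bump (a g₀ : G) {q : I × I → ℂ} (hq : Continuous q) :
    IsHat a (fun g => if g = g₀ then 1 else 0) fun p => bump p * q p where
  cont := by
    unfold bump
    fun_prop
  glue g s := by simp [bump]
  right s := by simp [bump]
  top s := by simp [bump]

/-- The function equal to `bump p * q p` on the square of `g₀` and zero off this square. -/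
noncomputable def squareFun (a : G) (hz : z * z = 1) (g₀ : G) {q : I × I → ℂ} (hq : Continuous q) :
    Surf a z → ℂ :=
  hat hz (isHat_bump a g₀ hq)

lemma continuous_squareFun (hz : z * z = 1) (g₀ : G) {q : I × I → ℂ} (hq : Continuous q) :
    Continuous (squareFun a hz g₀ hq) := continuous_hat hz _

lemma squareFun_mk_self (hz : z * z = 1) (hz1 : z ≠ 1) (g₀ : G) {q : I × I → ℂ}
    (hq : Continuous q) (p : I × I) :
    squareFun a hz g₀ hq (mk a z g₀ p) = bump p * q p := by
  rw [squareFun, ← Prod.mk.eta (p := p), hat_mk, if_pos rfl, if_neg (by simpa using hz1)]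
  simp

lemma squareFun_mk_ne_zero (hz : z * z = 1) {g₀ g : G} {q : I × I → ℂ} {hq : Continuous q}
    {p : I × I}
    (h : squareFun a hz g₀ hq (mk a z g p) ≠ 0) : bump p ≠ 0 ∧ (g = g₀ ∨ z * g = g₀) := by
  have hs : bump (σ p.1, σ p.2) = bump p := by
    rw [bump, bump, symm_symm, symm_symm, mul_comm (σ p.1), mul_comm (σ p.2)]
  rw [squareFun, ← Prod.mk.eta (p := p), hat_mk, hs] at h
  constructor
  · intro h0
    rw [Prod.mk.eta, h0] at h
    simp at h
  · by_contra! hg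
    rw [if_neg hg.1, if_neg hg.2] at h
    simp at h

lemma exists_of_squareFun_ne_zero (hz : z * z = 1) {g₀ : G} {q : I × I → ℂ} {hq : Continuous q}
    {P : Surf a z}
    (h : squareFun a hz g₀ hq P ≠ 0) : ∃ p, P = mk a z g₀ p := by
  obtain ⟨g, x, y, rfl⟩ := exists_mk P
  obtain ⟨-, rfl | rfl⟩ := squareFun_mk_ne_zero hz h
  · exact ⟨_, rfl⟩
  · exact ⟨_, mk_flip ..⟩

lemma eq_of_bump_mul_eq {p p' : I × I} (h0 : bump p ≠ 0)
    (h : ∀ q : I × I → ℂ, Continuous q → bump p * q p = bump p' * q p') : p = p' := by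
  have h1 := h (fun _ => 1) continuous_const
  have hx := h (fun p => (p.1 : ℝ)) (by fun_prop)
  have hy := h (fun p => (p.2 : ℝ)) (by fun_prop)
  rw [mul_one, mul_one] at h1
  rw [← h1] at hx hy
  have hx' := mul_left_cancel₀ h0 hx
  have hy' := mul_left_cancel₀ h0 hy
  exact Prod.ext (Subtype.ext (by exact_mod_cast hx')) (Subtype.ext (by exact_mod_cast hy'))

lemma eq_of_squareFun_eq (hz : z * z = 1) (hz1 : z ≠ 1) {g₀ : G} {p : I × I} {Q : Surf a z}
    (h0 : bump p ≠ 0) (h : ∀ (q : I × I → ℂ) (hq : Continuous q),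
      squareFun a hz g₀ hq (mk a z g₀ p) = squareFun a hz g₀ hq Q) : mk a z g₀ p = Q := by
  have h1 : squareFun a hz g₀ (continuous_const (y := (1 : ℂ))) Q ≠ 0 := by
    rwa [← h, squareFun_mk_self hz hz1, mul_one]
  obtain ⟨p', rfl⟩ := exists_of_squareFun_ne_zero hz h1
  simp only [squareFun_mk_self hz hz1] at h
  rw [eq_of_bump_mul_eq h0 h]

lemma eq_of_mk_eq_mk (hz : z * z = 1) (hz1 : z ≠ 1) {g : G} {p p' : I × I} (h0 : bump p ≠ 0)
    (h : mk a z g p = mk a z g p') : p = p' := by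
  refine eq_of_bump_mul_eq h0 fun q hq => ?_
  rw [← squareFun_mk_self (a := a) hz hz1 g hq, h, squareFun_mk_self hz hz1]

/-! ### Duality of vertices and faces -/

variable {b : G}

/-- The surfaces of `(a, z)` and `(az, z)` are the same, with the roles of vertices and face centres
exchanged; the identification reflects each square. -/
def dual (hb : b = a * z) : Surf b z → Surf a z :=
  Quot.lift (fun q => mk a z q.1 (σ q.2.1, q.2.2)) (by
    rintro _ _ (⟨g, s⟩ | ⟨g, x, y⟩)
    · simp only [symm_zero]
      rw [mk_flip, symm_one, mk_rot, ← mul_assoc, hb]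
    · exact mk_flip ..)

lemma dual_mk (hb : b = a * z) (g : G) (x y : I) :
    dual hb (mk b z g (x, y)) = mk a z g (σ x, y) := rfl

lemma continuous_dual (hb : b = a * z) : Continuous (dual hb) :=
  continuous_quot_lift _ (continuous_sigma fun g => (continuous_mk g).comp (by fun_prop))

lemma dual_dual (hb : b = a * z) (ha : a = b * z) (P : Surf a z) :
    dual hb (dual ha P) = P := by
  obtain ⟨g, x, y, rfl⟩ := exists_mk P
  rw [dual_mk, dual_mk, symm_symm]

/-! ### Topology of the surface -/

lemma height_mk_self_ne_zero (hz : z * z = 1) (g : G) {x y : I} (h : (x + y : ℝ) < 1) :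
    height a hz g (mk a z g (x, y)) ≠ 0 := by
  rw [height_mk_of_le hz _ _ h.le, mul_inv_cancel, ind_of_mem (one_mem _), one_mul, Ne,
    tent_eq_zero_iff]
  exact not_le.2 h

/-- The surface is covered by the open discs around vertices, the open discs around face centres,
and the open squares. -/
lemma exists_ne_zero (hz : z * z = 1) (hb : a = b * z) (P : Surf a z) :
    (∃ g, height a hz g P ≠ 0) ∨ (∃ g, height b hz g (dual hb P) ≠ 0) ∨
      ∃ g p, P = mk a z g p ∧ bump p ≠ 0 := by
  obtain ⟨g, x, y, rfl⟩ := exists_mk P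
  by_cases h : bump (x, y) = 0
  · rw [← not_ne_iff, bump_ne_zero_iff] at h
    simp only [not_and_or, not_not] at h
    -- a point on a side lies in the disc around one of the two corners
    have bottom : ∀ g (x : I), (∃ g', height a hz g' (mk a z g (x, 0)) ≠ 0) ∨
        ∃ g', height b hz g' (dual hb (mk a z g (x, 0))) ≠ 0 := by
      intro g x
      rcases eq_or_ne x 1 with rfl | hx
      · refine .inr ⟨g, ?_⟩
        rw [dual_mk]
        exact height_mk_self_ne_zero hz g (by simp)
      · refine .inl ⟨g, height_mk_self_ne_zero hz g ?_⟩
        rw [Set.Icc.coe_zero, add_zero]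
        exact unitInterval.lt_one_iff_ne_one.2 hx
    rw [← or_assoc]
    left
    rcases h with rfl | rfl | rfl | rfl
    · rw [mk_rot]
      exact bottom _ _
    · rw [mk_flip, symm_one, mk_rot]
      exact bottom _ _
    · exact bottom _ _
    · rw [mk_flip, symm_one]
      exact bottom _ _
  · exact .inr (.inr ⟨g, _, rfl, h⟩)

/-- Continuous functions separate the points: the heights and coordinates of the discs around
vertices and face centres, and the functions supported on single squares. -/
lemma t2Space (hz : z * z = 1) (hz1 : z ≠ 1) (ha : IsOfFinOrder a) (hm : IsOfFinOrder (a * z)) :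
    T2Space (Surf a z) := by
  refine T2Space.of_injective_continuous (f := fun P (f : C(Surf a z, ℂ)) => f P) ?_
    (continuous_pi fun f => f.continuous)
  intro P Q hPQ
  have sep : ∀ f : Surf a z → ℂ, Continuous f → f P = f Q := fun f hf =>
    congrFun hPQ ⟨f, hf⟩
  have hb : a = a * z * z := by rw [mul_assoc, hz, mul_one]
  obtain ⟨g, h⟩ | ⟨g, h⟩ | ⟨g, p, rfl, h⟩ := exists_ne_zero hz hb P
  · exact eq_of_height_eq_of_coord_eq hz ha h (sep _ (continuous_height hz _))
      (sep _ (continuous_coord hz ha _))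
  · have hcd := continuous_dual hb
    have : dual hb P = dual hb Q := eq_of_height_eq_of_coord_eq hz hm h
      (sep _ ((continuous_height hz _).comp hcd)) (sep _ ((continuous_coord hz hm _).comp hcd))
    rw [← dual_dual rfl hb P, this, dual_dual]
  · exact eq_of_squareFun_eq hz hz1 h fun q hq => sep _ (continuous_squareFun hz _ hq)

/-- A continuous map of a compact set `A` that is injective on the open set `U`, where `U` is cut
out in `A` by pulling back a continuous function whose support lies in the image, is an open
embedding on `U`. -/
lemma isOpenEmbedding_of_isCompact {X S : Type*} [TopologicalSpace X] [TopologicalSpace S]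
    [T2Space S] {φ : X → S} {c : S → ℂ} {U A : Set X} (hA : IsCompact A) (hφ : ContinuousOn φ A)
    (hc : Continuous c) (hU : IsOpen U) (hUA : U ⊆ A) (hinj : Set.InjOn φ U)
    (h1 : ∀ x ∈ A, c (φ x) ≠ 0 ↔ x ∈ U) (h2 : ∀ s, c s ≠ 0 → ∃ x ∈ A, φ x = s) :
    IsOpenEmbedding (U.domRestrict φ) := by
  refine .of_continuous_injective_isOpenMap
    (continuousOn_iff_continuous_domRestrict.1 (hφ.mono hUA)) hinj.injective fun W hW => ?_
  have hW' : IsOpen (Subtype.val '' W) := hU.isOpenMap_subtype_val W hW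
  have hcl : IsClosed (φ '' (A \ Subtype.val '' W)) :=
    ((hA.diff hW').image_of_continuousOn (hφ.mono Set.sdiff_subset)).isClosed
  have : U.domRestrict φ '' W = {s | c s ≠ 0} \ φ '' (A \ Subtype.val '' W) := by
    ext s
    constructor
    · rintro ⟨x, hx, rfl⟩
      refine ⟨(h1 _ (hUA x.2)).2 x.2, ?_⟩
      rintro ⟨y, ⟨hyA, hyW⟩, hy⟩
      have hyU : y ∈ U := (h1 y hyA).1 (by rw [hy]; exact (h1 _ (hUA x.2)).2 x.2)
      exact hyW ⟨x, hx, (hinj hyU x.2 hy).symm⟩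
    · rintro ⟨hs, hs'⟩
      obtain ⟨x, hxA, rfl⟩ := h2 s hs
      have hx : x ∈ Subtype.val '' W := by
        by_contra hx
        exact hs' ⟨x, ⟨hxA, hx⟩, rfl⟩
      obtain ⟨y, hy, rfl⟩ := hx
      exact ⟨y, hy, rfl⟩
  rw [this]
  exact (isOpen_ne.preimage hc).sdiff hcl

lemma isOpenEmbedding_disc (hz : z * z = 1) (hz1 : z ≠ 1) (ha : IsOfFinOrder a)
    (hm : IsOfFinOrder (a * z)) (g₀ : G) :
    IsOpenEmbedding ((Metric.ball (0 : ℂ) 1).domRestrict (disc a z g₀)) := by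
  have := t2Space hz hz1 ha hm
  refine isOpenEmbedding_of_isCompact (isCompact_closedBall 0 1) (continuousOn_disc ha g₀)
    (continuous_height hz g₀) Metric.isOpen_ball Metric.ball_subset_closedBall
    (disc_injOn hz ha g₀) (fun w hw => ?_) fun P hP => ?_
  · rw [mem_closedBall_zero_iff] at hw
    rw [height_disc hz ha g₀ hw, mem_ball_zero_iff, sub_ne_zero, lt_iff_le_and_ne, ne_comm]
    simp only [hw, true_and, ne_eq]
    norm_cast
  · obtain ⟨w, hw, h⟩ := exists_disc_of_height_ne_zero hz ha hP
    exact ⟨w, mem_closedBall_zero_iff.2 hw.le, h⟩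

lemma isOpenEmbedding_dual_disc (hz : z * z = 1) (hz1 : z ≠ 1) (ha : IsOfFinOrder a)
    (hb : b = a * z)
    (hm : IsOfFinOrder b) (g₀ : G) :
    IsOpenEmbedding ((Metric.ball (0 : ℂ) 1).domRestrict fun w => dual hb (disc b z g₀ w)) := by
  have hb' : a = b * z := by rw [hb, mul_assoc, hz, mul_one]
  let e : Surf b z ≃ₜ Surf a z :=
    { toFun := dual hb
      invFun := dual hb'
      left_inv := dual_dual hb' hb
      right_inv := dual_dual hb hb'
      continuous_toFun := continuous_dual hb
      continuous_invFun := continuous_dual hb' }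
  exact e.isOpenEmbedding.comp (isOpenEmbedding_disc hz hz1 hm (by rwa [← hb']) g₀)

/-- The square of `g₀`, parametrized by the unit square of the complex plane. -/
noncomputable def squareMap (a z g₀ : G) (w : ℂ) : Surf a z :=
  mk a z g₀ (Set.projIcc 0 1 zero_le_one w.re, Set.projIcc 0 1 zero_le_one w.im)

lemma isOpenEmbedding_square (hz : z * z = 1) (hz1 : z ≠ 1) (ha : IsOfFinOrder a)
    (hm : IsOfFinOrder (a * z))
    (g₀ : G) :
    IsOpenEmbedding ((Set.Ioo (0 : ℝ) 1 ×ℂ Set.Ioo (0 : ℝ) 1).domRestrict (squareMap a z g₀)) := by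
  have := t2Space hz hz1 ha hm
  have hI : Set.Ioo (0 : ℝ) 1 ×ℂ Set.Ioo (0 : ℝ) 1 ⊆ Set.Icc (0 : ℝ) 1 ×ℂ Set.Icc (0 : ℝ) 1 :=
    fun w hw => ⟨Set.Ioo_subset_Icc_self hw.1, Set.Ioo_subset_Icc_self hw.2⟩
  have hsq : ∀ w ∈ Set.Icc (0 : ℝ) 1 ×ℂ Set.Icc (0 : ℝ) 1,
      squareFun a hz g₀ continuous_const (q := fun _ => 1) (squareMap a z g₀ w) ≠ 0 ↔
        w ∈ Set.Ioo (0 : ℝ) 1 ×ℂ Set.Ioo (0 : ℝ) 1 := by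
    rintro w ⟨⟨hx0, hx1⟩, ⟨hy0, hy1⟩⟩
    rw [squareMap, squareFun_mk_self hz hz1, mul_one, bump_ne_zero_iff,
      Set.projIcc_of_mem zero_le_one ⟨hx0, hx1⟩, Set.projIcc_of_mem zero_le_one ⟨hy0, hy1⟩]
    simp only [Ne, Subtype.ext_iff, Set.Icc.coe_zero, Set.Icc.coe_one]
    rw [Complex.mem_reProdIm, Set.mem_Ioo, Set.mem_Ioo, lt_iff_le_and_ne, lt_iff_le_and_ne,
      lt_iff_le_and_ne, lt_iff_le_and_ne]
    tauto
  refine isOpenEmbedding_of_isCompact (isCompact_Icc.reProdIm isCompact_Icc)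
    (c := squareFun a hz g₀ continuous_const (q := fun _ => 1))
    (Continuous.continuousOn ?_) (continuous_squareFun hz g₀ _)
    (isOpen_Ioo.reProdIm isOpen_Ioo) hI ?_ hsq fun P hP => ?_
  · exact (continuous_mk g₀).comp ((continuous_projIcc.comp Complex.continuous_re).prodMk
      (continuous_projIcc.comp Complex.continuous_im))
  · intro w hw w' hw' h
    have hb := (hsq w (hI hw)).2 hw
    rw [squareMap, squareFun_mk_self hz hz1, mul_one] at hb
    have hp := eq_of_mk_eq_mk hz hz1 hb h
    rw [Set.projIcc_of_mem zero_le_one (hI hw).1, Set.projIcc_of_mem zero_le_one (hI hw).2,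
      Set.projIcc_of_mem zero_le_one (hI hw').1, Set.projIcc_of_mem zero_le_one (hI hw').2] at hp
    exact Complex.ext (congrArg (fun p : I × I => (p.1 : ℝ)) hp)
      (congrArg (fun p : I × I => (p.2 : ℝ)) hp)
  · obtain ⟨p, rfl⟩ := exists_of_squareFun_ne_zero hz hP
    refine ⟨⟨p.1, p.2⟩, ⟨p.1.2, p.2.2⟩, ?_⟩
    simp [squareMap]

lemma exists_chart {S : Type*} [TopologicalSpace S] {U : Set ℂ} (hU : IsOpen U) {φ : ℂ → S}
    (hφ : IsOpenEmbedding (U.domRestrict φ)) {w : ℂ} (hw : w ∈ U) :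
    ∃ e : OpenPartialHomeomorph S (EuclideanSpace ℝ (Fin 2)), φ w ∈ e.source := by
  have : Nonempty U := ⟨⟨w, hw⟩⟩
  refine ⟨((hφ.toOpenPartialHomeomorph _).symm.trans
    (hU.isOpenEmbedding_subtypeVal.toOpenPartialHomeomorph _)).transHomeomorph
      Complex.orthonormalBasisOneI.repr.toHomeomorph, ?_⟩
  simpa using ⟨w, hw, rfl⟩

lemma nonempty_chartedSpace (hz : z * z = 1) (hz1 : z ≠ 1) (ha : IsOfFinOrder a)
    (hm : IsOfFinOrder (a * z)) :
    Nonempty (ChartedSpace (EuclideanSpace ℝ (Fin 2)) (Surf a z)) := by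
  have hex : ∀ P : Surf a z,
      ∃ e : OpenPartialHomeomorph (Surf a z) (EuclideanSpace ℝ (Fin 2)), P ∈ e.source := by
    intro P
    have hb : a = a * z * z := by rw [mul_assoc, hz, mul_one]
    obtain ⟨g, h⟩ | ⟨g, h⟩ | ⟨g, p, rfl, h⟩ := exists_ne_zero hz hb P
    · obtain ⟨w, hw, rfl⟩ := exists_disc_of_height_ne_zero hz ha h
      exact exists_chart Metric.isOpen_ball (isOpenEmbedding_disc hz hz1 ha hm g)
        (mem_ball_zero_iff.2 hw)
    · obtain ⟨w, hw, h⟩ := exists_disc_of_height_ne_zero hz hm h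
      rw [← dual_dual rfl hb P, ← h]
      exact exists_chart Metric.isOpen_ball (isOpenEmbedding_dual_disc hz hz1 ha rfl hm g)
        (mem_ball_zero_iff.2 hw)
    · obtain ⟨hx0, hx1, hy0, hy1⟩ := (bump_ne_zero_iff p).1 h
      have hmem : (⟨p.1, p.2⟩ : ℂ) ∈ Set.Ioo (0 : ℝ) 1 ×ℂ Set.Ioo (0 : ℝ) 1 :=
        ⟨⟨unitInterval.pos_iff_ne_zero.2 hx0, unitInterval.lt_one_iff_ne_one.2 hx1⟩,
          ⟨unitInterval.pos_iff_ne_zero.2 hy0, unitInterval.lt_one_iff_ne_one.2 hy1⟩⟩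
      have : mk a z g p = squareMap a z g ⟨p.1, p.2⟩ := by simp [squareMap]
      rw [this]
      exact exists_chart (isOpen_Ioo.reProdIm isOpen_Ioo)
        (isOpenEmbedding_square hz hz1 ha hm g) hmem
  choose e he using hex
  exact ⟨{ atlas := Set.range e
           chartAt := e
           mem_chart_source := he
           chart_mem_atlas := fun P => ⟨P, rfl⟩ }⟩

lemma connectedSpace (hgen : Subgroup.closure {a, z} = ⊤) : ConnectedSpace (Surf a z) := by
  have hpre : ∀ g, IsPreconnected (Set.range (mk a z g)) := fun g =>
    isPreconnected_range (continuous_mk g)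
  have hsq : ∀ g p q, mk a z g p ∈ connectedComponent (mk a z g q) := fun g p q =>
    (hpre g).subset_connectedComponent ⟨q, rfl⟩ ⟨p, rfl⟩
  have hcorner : ∀ g, mk a z g (0, 0) ∈ connectedComponent (mk a z 1 (0, 0)) := by
    intro g
    have rot : ∀ g, connectedComponent (mk a z (a * g) (0, 0)) =
        connectedComponent (mk a z g (0, 0)) := fun g => by rw [← mk_rot]
    have flip : ∀ g, connectedComponent (mk a z (z * g) (0, 0)) =
        connectedComponent (mk a z g (0, 0)) := fun g => by
      have := mk_flip (a := a) (z := z) g 1 1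
      rw [symm_one] at this
      rw [← this]
      exact (connectedComponent_eq (hsq g (1, 1) (0, 0))).symm
    have : g ∈ Subgroup.closure {a, z} := hgen ▸ Subgroup.mem_top g
    suffices connectedComponent (mk a z g (0, 0)) = connectedComponent (mk a z 1 (0, 0)) from
      this ▸ mem_connectedComponent
    induction this using Subgroup.closure_induction_left with
    | one => rfl
    | mul_left x hx y hy ih =>
      rcases hx with rfl | rfl
      · rw [rot, ih]
      · rw [flip, ih]
    | inv_mul_cancel x hx y hy ih =>
      rcases hx with rfl | rfl
      · rw [← rot, mul_inv_cancel_left, ih]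
      · rw [← flip, mul_inv_cancel_left, ih]
  refine connectedSpace_iff_connectedComponent.2 ⟨mk a z 1 (0, 0), ?_⟩
  refine Set.eq_univ_of_forall fun P => ?_
  obtain ⟨g, x, y, rfl⟩ := exists_mk P
  rw [connectedComponent_eq (hcorner g)]
  exact hsq g _ _

lemma countable_of_closure_eq_top {s : Set G} (hs : s.Finite) (h : Subgroup.closure s = ⊤) :
    Countable G := by
  have : Finite s := hs
  have hsurj : Function.Surjective (FreeGroup.lift (Subtype.val : s → G)) := by
    rw [← MonoidHom.range_eq_top, FreeGroup.range_lift_eq_closure, Subtype.range_coe, h]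
  have : Countable (FreeGroup s) := inferInstanceAs (Countable (Quot _))
  exact hsurj.countable

lemma isSurface (hz : z * z = 1) (hz1 : z ≠ 1) (ha : IsOfFinOrder a) (hm : IsOfFinOrder (a * z))
    (hgen : Subgroup.closure {a, z} = ⊤) : IsSurface (Surf a z) where
  t2 := t2Space hz hz1 ha hm
  secondCountable := by
    have : Countable G := countable_of_closure_eq_top (Set.toFinite _) hgen
    obtain ⟨hch⟩ := nonempty_chartedSpace hz hz1 ha hm
    have : SigmaCompactSpace (Surf a z) := by
      have h := isSigmaCompact_range (f := (Quot.mk _ : _ → Surf a z)) continuous_quot_mk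
      rwa [Set.range_eq_univ.2 Quot.mk_surjective, isSigmaCompact_univ_iff] at h
    exact ChartedSpace.secondCountable_of_sigmaCompact (EuclideanSpace ℝ (Fin 2)) _
  connected := connectedSpace hgen
  locallyEuclidean := nonempty_chartedSpace hz hz1 ha hm

lemma compactSpace [Finite G] : CompactSpace (Surf a z) :=
  inferInstanceAs (CompactSpace (Quot (GlueRel a z)))

end Surf
end
/-! ### The embedding -/

section

open unitInterval Surf

variable {G : Type u} [Group G] {a z : G}

/-- A chosen representative of a right coset. -/
noncomputable def RightCosets.rep {H : Subgroup G} (T : RightCosets H) : G := T.exists_mk.choose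

lemma RightCosets.mk_rep {H : Subgroup G} (T : RightCosets H) : .mk H T.rep = T :=
  T.exists_mk.choose_spec.symm

lemma coset_eq_of_height_ne_zero (hz : z * z = 1) {g g' : G} {P : Surf a z}
    (h : height a hz g P ≠ 0) (h' : height a hz g' P ≠ 0) : coset a g = coset a g' := by
  obtain ⟨x, s, t, rfl, hx, hst⟩ := exists_of_height_ne_zero hz h
  rw [height_mk_of_le hz _ _ hst.le] at h'
  have hx' : x * g'⁻¹ ∈ Subgroup.zpowers a := by
    by_contra hx'
    exact h' (by rw [ind_of_notMem hx', zero_mul])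
  exact (coset_eq_iff.2 hx).symm.trans (coset_eq_iff.2 hx')

lemma mk_zero_eq_of_coset_eq {g h : G} (e : coset a g = coset a h) :
    mk a z g (0, 0) = mk a z h (0, 0) := by
  obtain ⟨j, hj⟩ := Subgroup.mem_zpowers_iff.1 (coset_eq_iff.1 e)
  rw [← mk_zpow_zero j h, hj, inv_mul_cancel_right]

lemma mk_zero_eq_iff (hz : z * z = 1) {g h : G} :
    mk a z g (0, 0) = mk a z h (0, 0) ↔ coset a g = coset a h := by
  refine ⟨fun e => ?_, mk_zero_eq_of_coset_eq⟩
  refine coset_eq_of_height_ne_zero hz (height_mk_self_ne_zero hz g (x := 0) (y := 0) (by simp)) ?_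
  rw [e]
  exact height_mk_self_ne_zero hz h (x := 0) (y := 0) (by simp)

lemma mk_one_one (g : G) : mk a z g (1, 1) = mk a z (z * g) (0, 0) := by
  rw [mk_flip, symm_one]

lemma bump_diag_ne_zero_iff {t : I} : bump (t, t) ≠ 0 ↔ t ≠ 0 ∧ t ≠ 1 := by
  rw [bump_ne_zero_iff]
  tauto

lemma bump_diag_ne_zero {t : I} (ht : t ∈ Set.Ioo (0 : I) 1) : bump (t, t) ≠ 0 :=
  bump_diag_ne_zero_iff.2 ⟨ht.1.ne', ht.2.ne⟩

lemma mk_diag_injective (hp : IsRotaryPair a z) (g : G) :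
    Function.Injective fun t : I => mk a z g (t, t) := by
  have hz := hp.mul_self
  have hne : mk a z g (0, 0) ≠ mk a z g (1, 1) := by
    rw [mk_one_one, Ne, mk_zero_eq_iff hz]
    exact coset_ne_coset_mul hp g
  intro s t h
  by_cases hs : bump (s, s) = 0
  · by_cases ht : bump (t, t) = 0
    · rw [← not_ne_iff, bump_diag_ne_zero_iff, not_and_or, not_not, not_not] at hs ht
      rcases hs with rfl | rfl <;> rcases ht with rfl | rfl
      · rfl
      · exact absurd h hne
      · exact absurd h.symm hne
      · rfl
    · exact (congrArg Prod.fst (eq_of_mk_eq_mk hz hp.ne_one ht h.symm)).symm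
  · exact congrArg Prod.fst (eq_of_mk_eq_mk hz hp.ne_one hs h)

/-- The height function of a face vanishes on all diagonals. -/
lemma height_dual_mk_diag {b : G} (hz : z * z = 1) (hb : a = b * z) (g₀ g : G) (t : I) :
    height b hz g₀ (dual hb (mk a z g (t, t))) = 0 := by
  have h : ((σ t : I) + t : ℝ) = 1 := by simp
  rw [dual_mk, height_mk_of_le hz _ _ h.le, (tent_eq_zero_iff (σ t, t)).2 h.ge, mul_zero]

/-- The two representatives of an edge draw the same arc, in opposite directions. -/
lemma mk_rep_diag (hz : z * z = 1) (g : G) :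
    (∀ t, mk a z g (t, t) = mk a z (coset z g).rep (t, t)) ∨
      ∀ t, mk a z g (t, t) = mk a z (coset z g).rep (σ t, σ t) := by
  have h := (coset z g).mk_rep
  rw [coset_involution_eq_iff hz] at h
  rcases h with h | h
  · left
    rw [h]
    exact fun t => rfl
  · right
    rw [h]
    exact fun t => mk_flip ..

/-- Vertices are drawn at the corners `(0, 0)` of the squares, edges as their diagonals, and the
faces are the discs around the vertices of the dual. -/
noncomputable def twoCellEmbedding (hp : IsRotaryPair a z) (hm : IsOfFinOrder (a * z)) :
    TwoCellEmbedding (rotaMap a z) (Surf a z) where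
  pt v := mk a z v.rep (0, 0)
  arc e := ⟨fun t => mk a z e.rep (t, t), (continuous_mk _).comp (by fun_prop)⟩
  cell f w := dual rfl (disc (a * z) z f.rep w)
  pt_injective v w h := by
    rw [← v.mk_rep, ← w.mk_rep]
    exact (mk_zero_eq_iff hp.mul_self).1 h
  arc_injective e := mk_diag_injective hp _
  arc_ends e := by
    have hset : {v | (rotaMap a z).Inc v e} = {coset a e.rep, coset a (z * e.rep)} := by
      ext v
      have : (rotaMap a z).Inc v e ↔ (rotaMap a z).Inc v (coset z e.rep) := by
        rw [coset, e.mk_rep]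
      exact this.trans (inc_coset_iff hp.mul_self)
    rw [hset, Set.image_pair]
    change {_, _} = {mk a z e.rep (0, 0), mk a z e.rep (1, 1)}
    rw [mk_one_one, mk_zero_eq_of_coset_eq (RightCosets.mk_rep (coset a e.rep)),
      mk_zero_eq_of_coset_eq (RightCosets.mk_rep (coset a (z * e.rep)))]
  pt_notMem_arc := by
    rintro v e ⟨t, ht, h⟩
    have h1 : squareFun a hp.mul_self e.rep (continuous_const (y := (1 : ℂ)))
        (mk a z e.rep (t, t)) ≠ 0 := by
      rw [squareFun_mk_self hp.mul_self hp.ne_one, mul_one]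
      exact bump_diag_ne_zero ht
    change mk a z e.rep (t, t) = mk a z v.rep (0, 0) at h
    rw [h] at h1
    exact bump_diag_ne_zero_iff.1 (squareFun_mk_ne_zero hp.mul_self h1).1 |>.1 rfl
  arc_disjoint := by
    intro e e' hne
    rw [Set.disjoint_left]
    rintro _ ⟨t, ht, rfl⟩ ⟨t', -, h⟩
    have h1 : squareFun a hp.mul_self e.rep (continuous_const (y := (1 : ℂ)))
        (mk a z e.rep (t, t)) ≠ 0 := by
      rw [squareFun_mk_self hp.mul_self hp.ne_one, mul_one]
      exact bump_diag_ne_zero ht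
    change mk a z e'.rep (t', t') = mk a z e.rep (t, t) at h
    rw [← h] at h1
    refine hne ?_
    rw [← e.mk_rep, ← e'.mk_rep, eq_comm, coset_involution_eq_iff hp.mul_self]
    refine (squareFun_mk_ne_zero hp.mul_self h1).2.imp id fun h => ?_
    rw [← h, ← mul_assoc, hp.mul_self, one_mul]
  arc_locallyFinite := by
    have hz := hp.mul_self
    have hb : a = a * z * z := by rw [mul_assoc, hz, mul_one]
    have key : ∀ (P : Surf a z) (c : Surf a z → ℂ), Continuous c → c P ≠ 0 →
        {e : RightCosets (Subgroup.zpowers z) | ∃ t, c (mk a z e.rep (t, t)) ≠ 0}.Finite →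
        ∃ U ∈ nhds P, {e : RightCosets (Subgroup.zpowers z) |
          (Set.range (fun t => mk a z e.rep (t, t)) ∩ U).Nonempty}.Finite := by
      intro P c hc hP hfin
      refine ⟨{Q | c Q ≠ 0}, (isOpen_ne.preimage hc).mem_nhds hP, hfin.subset ?_⟩
      rintro e ⟨_, ⟨t, rfl⟩, ht⟩
      exact ⟨t, ht⟩
    intro P
    obtain ⟨g, h⟩ | ⟨g, h⟩ | ⟨g, p, rfl, h⟩ := exists_ne_zero hz hb P
    · refine key P _ (continuous_height hz g) h ((isLocallyFinite hp (coset a g)).subset ?_)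
      rintro e ⟨t, ht⟩
      rw [← e.mk_rep]
      refine (inc_coset_iff hz).2 ?_
      rcases le_total (t + t : ℝ) 1 with h1 | h1
      · left
        rw [height_mk_of_le hz _ _ h1] at ht
        rw [eq_comm, coset_eq_iff]
        by_contra hx
        exact ht (by rw [ind_of_notMem hx, zero_mul])
      · right
        have h2 : ((σ t : I) + (σ t : I) : ℝ) ≤ 1 := by
          simp only [coe_symm_eq]
          linarith
        rw [mk_flip, height_mk_of_le hz _ _ h2] at ht
        rw [eq_comm, coset_eq_iff]
        by_contra hx
        exact ht (by rw [ind_of_notMem hx, zero_mul])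
    · refine key P _ ((continuous_height hz g).comp (continuous_dual hb)) h ?_
      convert Set.finite_empty
      refine Set.eq_empty_of_forall_notMem ?_
      rintro e ⟨t, ht⟩
      exact ht (height_dual_mk_diag hz hb _ _ _)
    · refine key _ _ (continuous_squareFun hz g (continuous_const (y := (1 : ℂ)))) ?_
        ((Set.finite_singleton (coset z g)).subset ?_)
      · rwa [squareFun_mk_self hz hp.ne_one, mul_one]
      · rintro e ⟨t, ht⟩
        rw [Set.mem_singleton_iff, ← e.mk_rep, coset_involution_eq_iff hz]
        refine (squareFun_mk_ne_zero hz ht).2.imp id fun h => ?_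
        rw [← h, ← mul_assoc, hz, one_mul]
  cell_continuousOn f := (continuous_dual rfl).comp_continuousOn (continuousOn_disc hm _)
  cell_isOpenEmbedding f :=
    isOpenEmbedding_dual_disc hp.mul_self hp.ne_one hp.finite_order rfl hm _
  cell_disjoint := by
    intro f f' hne
    have hz := hp.mul_self
    have hb : a = a * z * z := by rw [mul_assoc, hz, mul_one]
    rw [Set.disjoint_left]
    rintro _ ⟨w, hw, rfl⟩ ⟨w', hw', h⟩
    refine hne ?_
    rw [mem_ball_zero_iff] at hw hw'
    have hpos : ∀ (g : G) (w : ℂ), ‖w‖ < 1 → height (a * z) hz g (disc (a * z) z g w) ≠ 0 := by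
      intro g w hw
      rw [height_disc hz hm g hw.le, sub_ne_zero]
      exact_mod_cast hw.ne'
    rw [← f.mk_rep, ← f'.mk_rep]
    refine coset_eq_of_height_ne_zero hz (hpos _ _ hw) ?_
    have h' := congrArg (dual hb) h
    rw [dual_dual, dual_dual] at h'
    rw [← h']
    exact hpos _ _ hw'
  iUnion_cell := by
    have hz := hp.mul_self
    have hb : a = a * z * z := by rw [mul_assoc, hz, mul_one]
    ext P
    rw [Set.mem_iUnion, Set.mem_compl_iff, Set.mem_union, Set.mem_iUnion, not_or]
    constructor
    · rintro ⟨f, w, hw, rfl⟩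
      rw [mem_ball_zero_iff] at hw
      have hdiag : ∀ g t, mk a z g (t, t) ≠ dual rfl (disc (a * z) z f.rep w) := by
        intro g t h
        have h1 := height_dual_mk_diag hz hb f.rep g t
        rw [h, dual_dual, height_disc hz hm _ hw.le, sub_eq_zero] at h1
        exact hw.ne' (by exact_mod_cast h1)
      constructor
      · rintro ⟨v, hv⟩
        exact hdiag _ _ hv
      · rintro ⟨e, t, ht⟩
        exact hdiag _ _ ht
    · rintro ⟨-, hP⟩
      have below : ∀ g (x y : I), P = mk a z g (x, y) → y < x →
          ∃ f : RightCosets (Subgroup.zpowers (a * z)), P ∈ (fun w => dual rfl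
            (disc (a * z) z f.rep w)) '' Metric.ball 0 1 := by
        intro g x y h hxy
        have hxy' : ((σ x : I) + y : ℝ) < 1 := by
          have : (y : ℝ) < x := hxy
          rw [coe_symm_eq]
          linarith
        obtain ⟨w, hw, hd⟩ := exists_disc_eq (z := z) hm
          (coset_eq_iff.1 (RightCosets.mk_rep (coset (a * z) g)).symm) hxy'.le
        refine ⟨coset (a * z) g, w, mem_ball_zero_iff.2 (hw ▸ hxy'), ?_⟩
        simp only
        rw [hd, dual_mk, symm_symm, h]
      obtain ⟨g, x, y, h⟩ := exists_mk P
      rcases lt_trichotomy y x with hxy | rfl | hxy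
      · exact below g x y h hxy
      · refine absurd ⟨coset z g, ?_⟩ hP
        rcases mk_rep_diag (a := a) hz g with h1 | h1
        · exact ⟨y, (h1 y).symm.trans h.symm⟩
        · exact ⟨σ y, (h1 y).symm.trans h.symm⟩
      · exact below _ _ _ (h.trans (mk_flip ..)) (symm_lt_symm.2 hxy)
  cell_boundary f := by
    have hz := hp.mul_self
    refine ⟨edgeSeq a z f.rep, ?_, fun i hi => ?_⟩
    · have h := bdry_coset hm f.rep
      rw [coset, f.mk_rep] at h
      rw [h]
      exact .inl (List.IsRotated.refl _)
    · have hd : ∀ t : I, dual rfl (disc (a * z) z f.rep (Complex.exp (2 * Real.pi * Complex.I *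
          ((i + (t : ℝ)) / (edgeSeq a z f.rep).length)))) =
            mk a z ((a * z) ^ i * f.rep) (t, t) := by
        intro t
        have h1 := disc_polar (z := z) hm f.rep i 1 t
        rw [Set.Icc.coe_one, Complex.ofReal_one, one_mul, turn, triPoint, one_mul, one_mul,
          zpow_natCast, Int.cast_natCast] at h1
        rw [length_edgeSeq, h1, dual_mk, symm_symm]
      rw [getElem_edgeSeq]
      rcases mk_rep_diag (a := a) hz ((a * z) ^ i * f.rep) with h1 | h1
      · exact .inl fun t => (hd t).trans (h1 t)
      · exact .inr fun t => (hd t).trans (h1 t)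

lemma isMap (hp : IsRotaryPair a z)
    (hne : Subgroup.zpowers a ≠ conjSubgroup (Subgroup.zpowers a) z) (hm : IsOfFinOrder (a * z)) :
    IsMap (rotaMap a z) (Surf a z) where
  isGraph := isGraph hp
  isConnected := isConnected hp
  isLocallyFinite := isLocallyFinite hp
  bdry_cycle := exists_isCycle_bdry hp hne hm
  incEF_iff _ _ hl := incEF_iff_mem hp hne hm hl
  incVF_iff _ _ hl := incVF_iff_exists_mem hp hne hm hl
  isSurface := Surf.isSurface hp.mul_self hp.ne_one hp.finite_order hm hp.generates
  embedding := ⟨twoCellEmbedding hp hm⟩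

end

end RotaryMaps

theorem proposition4p2 {G : Type u} [Group G] (a z : G) (hp : IsRotaryPair a z)
    (ha : 3 ≤ orderOf a)
    (hne : Subgroup.zpowers a ≠ conjSubgroup (Subgroup.zpowers a) z)
    (hm : IsOfFinOrder (a * z))
    (H K : Subgroup G) (hH : H = Subgroup.zpowers a) (hK : K = Subgroup.zpowers (a * z))
    (k lam m lam' : ℕ)
    (hk : k = (H ⊓ conjSubgroup H z).relIndex H)
    (hlam : lam = Nat.card ↥(H ⊓ conjSubgroup H z))
    (hm' : m = orderOf (a * z))
    (hlam' : lam' = Nat.card ↥(H ⊓ K)) :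
    -- (a) a map in a surface, rotary under right multiplication by `G`
    (∃ (S : Type u) (_ : TopologicalSpace S),
      IsMap (rotaMap a z) S ∧ (Finite G → CompactSpace S)) ∧
    IsRotary Gᵐᵒᵖ (rotaMap a z) ∧
    (rotaMap a z).HasValency k ∧
    (rotaMap a z).HasEdgeMultiplicity lam ∧
    HasFaceLength (rotaMap a z) m ∧
    -- (b) boundary cycles, with `⟨az⟩` the base face
    (rotaMap a z).bdry (RightCosets.mk _ 1) = seqClass (cycleSeq a z) ∧
    (∀ g : G, (rotaMap a z).bdry (op g • RightCosets.mk _ 1) =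
      List.map (op g • ·) '' (rotaMap a z).bdry (RightCosets.mk _ 1)) ∧
    (∀ f, ∀ l ∈ (rotaMap a z).bdry f, (rotaMap a z).IsRegularCycle l ∧ l.length = m ∧
      Nonempty (((rotaMap a z).edgeInduced {e | e ∈ l}).Iso
        ((cycleGraph (m / lam')).extender lam'))) ∧
    3 ≤ m / lam' ∧
    lam' ∣ Nat.gcd m lam ∧
    MulAction.stabilizer Gᵐᵒᵖ (RightCosets.mk (Subgroup.zpowers (a * z)) 1) = K.op ∧
    (∀ g : G, List.map (op g • ·) '' (rotaMap a z).bdry (RightCosets.mk _ 1) =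
      (rotaMap a z).bdry (RightCosets.mk _ 1) ↔ g ∈ K) ∧
    -- (c) kernels on `V` and on `V ∪ F`, and circularity
    (MulAction.toPermHom Gᵐᵒᵖ (RightCosets (Subgroup.zpowers a))).ker =
      (H ⊓ Subgroup.zpowers (z⁻¹ * a * z)).op ∧
    (MulAction.toPermHom Gᵐᵒᵖ
      (RightCosets (Subgroup.zpowers a) ⊕ RightCosets (Subgroup.zpowers (a * z)))).ker =
      (H ⊓ K).op ∧
    Nonempty (↥(H ⊓ K) ≃* Multiplicative (ZMod lam')) ∧
    (IsCircular (rotaMap a z) ↔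
      FaithfulSMul Gᵐᵒᵖ
        (RightCosets (Subgroup.zpowers a) ⊕ RightCosets (Subgroup.zpowers (a * z)))) ∧
    (IsCircular (rotaMap a z) ↔ lam' = 1) ∧
    -- (d) `z` interchanges the two faces `f` and `f z` at the edge `⟨z⟩`
    (RightCosets.mk (Subgroup.zpowers (a * z)) 1 ≠
      op z • RightCosets.mk (Subgroup.zpowers (a * z)) 1 ∧
    {f | (rotaMap a z).IncEF (RightCosets.mk _ 1) f} =
      {RightCosets.mk _ 1, op z • RightCosets.mk _ 1} ∧
    op z • op z • RightCosets.mk (Subgroup.zpowers (a * z)) 1 =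
      RightCosets.mk (Subgroup.zpowers (a * z)) 1) := by
  subst hH hK hk hlam hm'
  have hz := hp.mul_self
  obtain ⟨n, h3, hn, hnm⟩ := exists_period hp hne hm
  rw [← hlam'] at hnm
  have hpos : 0 < lam' := by
    refine Nat.pos_of_ne_zero fun h => hm.orderOf_pos.ne' ?_
    rw [← hnm, h, mul_zero]
  have hdiv : orderOf (a * z) / lam' = n := by
    rw [← hnm, Nat.mul_div_cancel _ hpos]
  refine ⟨⟨Surf a z, inferInstance, isMap hp hne hm, fun _ => Surf.compactSpace⟩,
    isRotary hp hm, hasValency hp, hasEdgeMultiplicity hp, hasFaceLength hp hne hm, ?_,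
    fun g => bdry_smul hm _ _, fun f l hl => ?_, hdiv ▸ h3, ?_, ?_, image_bdry_eq_iff hp ha hne hm,
    ?_, ker_toPermHom_vertices_faces hp, ?_, ?_, hlam' ▸ isCircular_iff hp hne hm, ?_, ?_, ?_⟩
  · rw [← edgeSeq_one]
    exact bdry_coset hm 1
  · obtain ⟨g, rfl⟩ := f.exists_mk
    obtain ⟨α, e, hc, rfl, -⟩ := exists_isPeriodicCycle hp hne hm h3 hn hl
    rw [hdiv]
    exact ⟨hc.isRegularCycle, IsPeriodicCycle.length_list _ _, hc.nonempty_iso hnm.symm⟩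
  · refine Nat.dvd_gcd ⟨n, by rw [mul_comm, hnm]⟩ ?_
    rw [hlam']
    exact Subgroup.card_dvd_of_le (inf_le_conj hp)
  · ext x
    rw [mem_stabilizer_coset, Subgroup.mem_op, one_mul, inv_one, mul_one]
  · rw [← conjSubgroup_zpowers]
    exact ker_toPermHom_vertices hp
  · have : IsCyclic ↥(Subgroup.zpowers a ⊓ Subgroup.zpowers (a * z)) :=
      isCyclic_of_injective (Subgroup.inclusion inf_le_left)
        (Subgroup.inclusion_injective (inf_le_left : _ ≤ Subgroup.zpowers a))
    exact ⟨hlam' ▸ (zmodCyclicMulEquiv this).symm⟩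
  · rw [isCircular_iff hp hne hm, faithfulSMul_iff hp]
  · rw [RightCosets.op_smul_mk, one_mul, Ne, eq_comm, RightCosets.mk_eq_mk, inv_one, mul_one]
    exact notMem_zpowers_mul hp hne
  · ext f
    rw [RightCosets.op_smul_mk, one_mul, Set.mem_ofPred_eq]
    refine (incEF_coset_iff hz).trans ?_
    rw [mul_one]
    rfl
  · rw [RightCosets.op_smul_mk, RightCosets.op_smul_mk, one_mul, hz]
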